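/- **Theorem (flat coordinates are Liouville).** Let $\Omega\subseteq\mathbb R^N$ be open. A (nonlocal) bracket of hydrodynamic type on $\Omega$ is $$\{I,J\}=\int \frac{\delta I}{\delta w^i(x)}\Big(g^{ij}(w)\frac{d}{dx}+b^{ij}_k(w)\,w^k_x+K\,w^i_x\Big(\frac{d}{dx}\Big)^{-1}w^j_x\Big)\frac{\delta J}{\delta w^j(x)}\,dx ,$$ with $g^{ij},b^{ij}_k$ smooth on $\Omega$, $K$ a real constant and $(d/dx)^{-1}=\frac12\big(\int_{-\infty}^x-\int_x^{\infty}\big)$. It acts on functionals, with smooth variational derivatives constant near $x=\pm\infty$ and depending smoothly on the field, of smooth fields $w:\mathbb R\to\Omega$ that are equal to a constant outside a compact set. It is a Poisson bracket if it is skew-symmetric and satisfies the Jacobi identity; it is local if $K=0$; two brackets are compatible if all their linear combinations with constant coefficients are Poisson brackets. Summation over repeated indices is understood. Let $\{\cdot,\cdot\}_2$ be a local Poisson bracket and $\{\cdot,\cdot\}_1$ an arbitrary, possibly degenerate, Poisson bracket of the above form with constant $K_1$, compatible with $\{\cdot,\cdot\}_2$. Let $u=(u^1,\dots,u^N)$ be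 flat coordinates of $\{\cdot,\cdot\}_2$ on an open subset of $\Omega$ on which $\{\cdot,\cdot\}_2$ is nondegenerate ($\det g_2^{ij}\not\equiv0$), that is, smooth local coordinates in which $g_2^{ij}=\eta^{ij}=\mathrm{const}$ and $b^{ij}_{2,k}=0$. Let $V\subseteq\mathbb R^N$ be any convex open subset of the range of these coordinates (for instance a small ball around any given point). Then: 1. The coordinates $u$, restricted to $V$, are Liouville for $\{\cdot,\cdot\}_1$: the functionals $U^i=\int u^i(x)\,dx$ (normalized by subtracting from $u^i(x)$ its value at infinity) satisfy $\{U^i,U^j\}_1=0$, $1\le i,j\le N$, on all fields with values in $V$. 2. There is a Liouville function of $\{\cdot,\cdot\}_1$ on $V$, that is, a smooth matrix function $\Phi^{ij}(u)$ such that, for the coefficients of $\{\cdot,\cdot\}_1$ in the coordinates $u$, $$g_1^{ij}=\Phi^{ij}+\Phi^{ji}-K_1u^iu^j,\qquad b^{ij}_{1,k}=\frac{\partial\Phi^{ij}}{\partial u^k}-K_1\delta^i_k u^j .$$ 3. Every Liouville function $\Phi$ of $\{\cdot,\cdot\}_1$ on $V$ has the special form $$\Phi^{ij}(u)=\eta^{is}\frac{\partial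 H^j}{\partial u^s}$$ for some smooth functions $H^1,\dots,H^N$ on $V$. -/

import Mathlib

open scoped ContDiff

namespace HydroBracket

/-- Values of the fields `u = (u¹, …, u^N)`. -/
abbrev Vec (N : ℕ) := Fin N → ℝ

/-- The partial derivative `∂f/∂u^k`. -/
noncomputable def pd {N : ℕ} (k : Fin N) (f : Vec N → ℝ) (u : Vec N) : ℝ :=
  fderiv ℝ f u (Pi.single k 1)

/-! ### Fields and functionals -/

/-- The fields: smooth maps `u : ℝ → Ω` which are equal to a constant outside a compact set
(the same constant at both ends, so that integrals of total `x`-derivatives vanish). -/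
def IsField {N : ℕ} (Ω : Set (Vec N)) (u : ℝ → Vec N) : Prop :=
  ContDiff ℝ ∞ u ∧ (∀ x, u x ∈ Ω) ∧ ∃ c : Vec N, HasCompactSupport (fun x => u x - c)

/-- `a = δI/δu` is the variational derivative of the functional `I` at the field `u`:
`d/dε I[u + ε v] = ∫ aᵢ(x) vⁱ(x) dx` at `ε = 0` for all compactly supported variations `v`. -/
def IsVarDeriv {N : ℕ} (I : (ℝ → Vec N) → ℝ) (u a : ℝ → Vec N) : Prop :=
  ContDiff ℝ ∞ a ∧
    ∀ v : ℝ → Vec N, ContDiff ℝ ∞ v → HasCompactSupport v →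
      HasDerivAt (fun ε : ℝ => I (u + ε • v)) (∫ x, ∑ i, a x i * v x i) 0

open Classical in
/-- The variational derivative `δI/δu(x)` (zero if it does not exist). -/
noncomputable def varDeriv {N : ℕ} (I : (ℝ → Vec N) → ℝ) (u : ℝ → Vec N) : ℝ → Vec N :=
  if h : ∃ a, IsVarDeriv I u a then h.choose else 0

/-- The variational derivative is unique. -/
theorem IsVarDeriv.unique {N : ℕ} {I : (ℝ → Vec N) → ℝ} {u a b : ℝ → Vec N}
    (ha : IsVarDeriv I u a) (hb : IsVarDeriv I u b) : a = b := by
  obtain ⟨ha1, ha2⟩ := ha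
  obtain ⟨hb1, hb2⟩ := hb
  have hac : ∀ i, Continuous fun x => a x i := fun i =>
    (continuous_apply i).comp ha1.continuous
  have hbc : ∀ i, Continuous fun x => b x i := fun i =>
    (continuous_apply i).comp hb1.continuous
  have key : ∀ i, (fun x => a x i - b x i) = fun _ => 0 := by
    intro i
    have hcont : Continuous fun x => a x i - b x i := (hac i).sub (hbc i)
    have hae : ∀ᵐ x ∂(MeasureTheory.volume : MeasureTheory.Measure ℝ), a x i - b x i = 0 := by
      apply ae_eq_zero_of_integral_contDiff_smul_eq_zero hcont.locallyIntegrable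
      intro f hf hfs
      have hv1 : ContDiff ℝ ∞ (fun x => (Pi.single i (f x) : Vec N)) := by
        rw [contDiff_pi]
        intro j
        by_cases hj : j = i
        · subst hj; simpa using hf
        · simpa [Pi.single_apply, hj] using contDiff_const
      have hv2 : HasCompactSupport (fun x => (Pi.single i (f x) : Vec N)) :=
        hfs.comp_left (g := fun t : ℝ => (Pi.single i t : Vec N)) (by simp)
      have h := (ha2 _ hv1 hv2).unique (hb2 _ hv1 hv2)
      have e : ∀ (w : ℝ → Vec N) (x : ℝ),
          ∑ j, w x j * (Pi.single i (f x) : Vec N) j = w x i * f x := by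
        intro w x
        simp [Pi.single_apply]
      simp only [e] at h
      have i1 : MeasureTheory.Integrable fun x => a x i * f x :=
        ((hac i).mul hf.continuous).integrable_of_hasCompactSupport hfs.mul_left
      have i2 : MeasureTheory.Integrable fun x => b x i * f x :=
        ((hbc i).mul hf.continuous).integrable_of_hasCompactSupport hfs.mul_left
      have h3 : (fun x => f x • (a x i - b x i)) = fun x => a x i * f x - b x i * f x := by
        funext x; simp only [smul_eq_mul]; ring
      rw [h3, MeasureTheory.integral_sub i1 i2, h, sub_self]
    exact MeasureTheory.Measure.eq_of_ae_eq hae hcont continuous_const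
  funext x i
  exact sub_eq_zero.mp (congrFun (key i) x)

theorem IsVarDeriv.varDeriv_eq {N : ℕ} {I : (ℝ → Vec N) → ℝ} {u a : ℝ → Vec N}
    (ha : IsVarDeriv I u a) : varDeriv I u = a := by
  have h : ∃ a, IsVarDeriv I u a := ⟨a, ha⟩
  have e : varDeriv I u = h.choose := by simp only [varDeriv, dif_pos h]
  rw [e]
  exact h.choose_spec.unique ha

/-- A smooth finite-parameter family of fields in `Ω` with a fixed value at infinity. -/
def IsFamily {N n : ℕ} (Ω : Set (Vec N)) (U : Vec n → ℝ → Vec N) : Prop :=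
  ContDiff ℝ ∞ (fun q : Vec n × ℝ => U q.1 q.2) ∧ (∀ p x, U p x ∈ Ω) ∧
    ∃ c : Vec N, ∀ S : Set (Vec n), IsCompact S →
      ∃ R : ℝ, ∀ p ∈ S, ∀ x : ℝ, R ≤ |x| → U p x = c

/-- The functionals: `I[u]` has a variational derivative at all fields, and this derivative
depends smoothly on the field and is constant near `x = ± ∞`.  Examples are
`∫ f(x) h(u, u_x, …) dx` with `f` of compact support and
`∫ (h(u, u_x, …) - h(u, u_x, …)|_∞) dx`. -/
def IsFunctional {N : ℕ} (Ω : Set (Vec N)) (I : (ℝ → Vec N) → ℝ) : Prop :=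
  (∀ u, IsField Ω u → ∃ a, IsVarDeriv I u a) ∧
  ∀ (n : ℕ) (U : Vec n → ℝ → Vec N), IsFamily Ω U →
    ContDiff ℝ ∞ (fun q : Vec n × ℝ => varDeriv I (U q.1) q.2) ∧
    ∀ S : Set (Vec n), IsCompact S →
      ∃ R : ℝ, ∀ p ∈ S, ∃ d : Vec N, ∀ x : ℝ, R ≤ |x| → varDeriv I (U p) x = d

/-! ### Nonlocal brackets of hydrodynamic type -/

/-- The operator `(d/dx)⁻¹ = ½ (∫_{-∞}^x - ∫_x^∞)`. -/
noncomputable def dinv (f : ℝ → ℝ) (x : ℝ) : ℝ :=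
  (1 / 2) * ((∫ y in Set.Iic x, f y) - ∫ y in Set.Ioi x, f y)

/-- The coefficients `g^{ij}(u)`, `b^{ij}_k(u)` (written `b u i j k`) and the constant `K` of a
bracket of hydrodynamic type. -/
structure Bracket (N : ℕ) where
  g : Vec N → Matrix (Fin N) (Fin N) ℝ
  b : Vec N → Fin N → Fin N → Fin N → ℝ
  K : ℝ

namespace Bracket

variable {N : ℕ}

/-- The coefficients are smooth on `Ω`. -/
def SmoothOn (B : Bracket N) (Ω : Set (Vec N)) : Prop :=
  (∀ i j, ContDiffOn ℝ ∞ (fun u => B.g u i j) Ω) ∧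
  ∀ i j k, ContDiffOn ℝ ∞ (fun u => B.b u i j k) Ω

/-- The operator `P^{ij} = g^{ij} d/dx + b^{ij}_k u^k_x + K u^i_x (d/dx)⁻¹ u^j_x` at the field
`u`, applied to `ψ`. -/
noncomputable def op (B : Bracket N) (u ψ : ℝ → Vec N) (x : ℝ) (i : Fin N) : ℝ :=
  (∑ j, (B.g (u x) i j * deriv (fun y => ψ y j) x
      + (∑ k, B.b (u x) i j k * deriv (fun y => u y k) x) * ψ x j))
    + B.K * deriv (fun y => u y i) x
        * dinv (fun y => ∑ j, deriv (fun z => u z j) y * ψ y j) x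

/-- `{I, J} = ∫ δI/δuⁱ(x) P^{ij} δJ/δu^j(x) dx`. -/
noncomputable def bracket (B : Bracket N) (I J : (ℝ → Vec N) → ℝ) (u : ℝ → Vec N) : ℝ :=
  ∫ x, ∑ i, varDeriv I u x i * B.op u (varDeriv J u) x i

/-- The bracket is a Poisson bracket on the functionals of fields with values in `Ω`:
a skew-symmetric operation which satisfies the Jacobi identity. -/
def IsPoisson (B : Bracket N) (Ω : Set (Vec N)) : Prop :=
  (∀ I J, IsFunctional Ω I → IsFunctional Ω J → IsFunctional Ω (B.bracket I J)) ∧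
  (∀ I J, IsFunctional Ω I → IsFunctional Ω J →
    ∀ u, IsField Ω u → B.bracket I J u = - B.bracket J I u) ∧
  ∀ I J L, IsFunctional Ω I → IsFunctional Ω J → IsFunctional Ω L →
    ∀ u, IsField Ω u →
      B.bracket (B.bracket I J) L u + B.bracket (B.bracket J L) I u
        + B.bracket (B.bracket L I) J u = 0

/-- The linear combination `α {·,·}_B + β {·,·}_C`. -/
def lin (α β : ℝ) (B C : Bracket N) : Bracket N where
  g u := α • B.g u + β • C.g u
  b u i j k := α * B.b u i j k + β * C.b u i j k
  K := α * B.K + β * C.K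

/-- Compatibility: all linear combinations are Poisson brackets (in particular both brackets). -/
def Compatible (Ω : Set (Vec N)) (B C : Bracket N) : Prop :=
  ∀ α β : ℝ, (lin α β B C).IsPoisson Ω

/-- `det g^{ij} ≢ 0` on `W`. -/
def IsNondegenerateOn (B : Bracket N) (W : Set (Vec N)) : Prop :=
  ∃ w ∈ W, (B.g w).det ≠ 0

end Bracket

/-! ### Local coordinates -/

variable {N : ℕ}

/-- `φ` is a system of smooth local coordinates `u = φ(w)` on `φ.source`. -/
def IsCoordinates (φ : OpenPartialHomeomorph (Vec N) (Vec N)) : Prop :=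
  ContDiffOn ℝ ∞ φ φ.source ∧ ContDiffOn ℝ ∞ φ.symm φ.target

/-- The coefficients of the bracket in the coordinates `u = φ(w)`: the operator `P` becomes
`J P Jᵀ` with `J = ∂u/∂w`, that is, with `w = φ⁻¹(u)`,
`g'^{ij}(u) = ∂uⁱ/∂wᵃ g^{ac}(w) ∂uʲ/∂wᶜ` and
`b'^{ij}_k(u) = ∂uⁱ/∂wᵃ (g^{ae}(w) ∂²uʲ/∂wᵉ∂wᶜ + b^{ae}_c(w) ∂uʲ/∂wᵉ) ∂wᶜ/∂uᵏ`. -/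
noncomputable def Bracket.inCoordinates (B : Bracket N)
    (φ : OpenPartialHomeomorph (Vec N) (Vec N)) : Bracket N where
  g u := fun i j =>
    ∑ a, ∑ c, pd a (fun w => φ w i) (φ.symm u) * B.g (φ.symm u) a c
      * pd c (fun w => φ w j) (φ.symm u)
  b u i j k :=
    ∑ a, ∑ e, ∑ c, pd a (fun w => φ w i) (φ.symm u)
      * (B.g (φ.symm u) a e * pd c (fun w => pd e (fun w' => φ w' j) w) (φ.symm u)
          + B.b (φ.symm u) a e c * pd e (fun w => φ w j) (φ.symm u))
      * pd k (fun v => φ.symm v c) u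
  K := B.K

/-- `φ` are flat coordinates of the local bracket `B`: in them `g^{ij} = η^{ij}` is constant and
`b^{ij}_k = 0`. -/
def IsFlatCoordinates (B : Bracket N) (φ : OpenPartialHomeomorph (Vec N) (Vec N))
    (η : Matrix (Fin N) (Fin N) ℝ) : Prop :=
  IsCoordinates φ ∧
    ∀ u ∈ φ.target, (B.inCoordinates φ).g u = η ∧ ∀ i j k, (B.inCoordinates φ).b u i j k = 0

/-- The functional `Uⁱ = ∫ uⁱ(x) dx`, `u = φ(w)`, of the field `w`, normalized by the constant
value of the field at infinity (which does not change its variational derivative). -/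
noncomputable def coordFunctional (φ : Vec N → Vec N) (i : Fin N) (w : ℝ → Vec N) : ℝ :=
  ∫ x, (φ (w x) i - φ (Filter.limUnder Filter.atTop w) i)

/-- The coordinates `u = φ(w)` on `W` are Liouville for the bracket: the fields `uⁱ(x)` are
densities of integrals in involution. -/
def IsLiouvilleCoordinates (B : Bracket N) (φ : Vec N → Vec N) (W : Set (Vec N)) : Prop :=
  ∀ i j, ∀ w, IsField W w → B.bracket (coordFunctional φ i) (coordFunctional φ j) w = 0

/-- `Φ` is a Liouville function on `V` of a bracket written in the coordinates `u`. -/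
def IsLiouvilleFunction (B : Bracket N) (V : Set (Vec N))
    (Φ : Vec N → Matrix (Fin N) (Fin N) ℝ) : Prop :=
  (∀ i j, ContDiffOn ℝ ∞ (fun u => Φ u i j) V) ∧
  ∀ u ∈ V, ∀ i j,
    B.g u i j = Φ u i j + Φ u j i - B.K * u i * u j ∧
    ∀ k, B.b u i j k = pd k (fun v => Φ v i j) u - B.K * (if i = k then 1 else 0) * u j

end HydroBracket

namespace HydroBracket

open MeasureTheory

/-! ### Partial derivatives -/

/-! The mechanism is the Jacobi identity tested on functionals linear in the flat coordinates. For
`∫ f uⁱ dx` and `∫ g uʲ dx` the second bracket is `∫ f ηⁱʲ g' dx`, independent of the field. Hence,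
subtracting the Jacobi identity of `{·,·}₁` from that of `{·,·}₁ + {·,·}₂`, only one cyclic sum
survives: the derivatives of the `{·,·}₁`-brackets along the flows `uˢ ↦ ηˢᵐ l'` generated by the
second bracket (`Bracket.Compatible.mixed_jacobi`).

Take `∫ f uⁱ`, `∫ g uʲ`, `∫ l uᵐ` with `g = 1` on a large interval containing the supports of `f`
and `l` and the nonconstant part of the field. Then `∫ g uʲ` imitates `Uʲ`. Its bracket with `∫ f
uⁱ` is `∫ f θ_k(u) u^k_x dx`, where `θ_k = b^{ij}_k + K δⁱ_k (uʲ - cʲ)` and `c` is the value at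
infinity, and its `{·,·}₂`-flow does not touch `f` or `l`. What remains is
`IsExtension.integral_form_eq`, an identity between two first variations. At a constant field it
says that `b^{ij}_k η^{km}` is symmetric in `i` and `m` (`sum_b_mul_eq`). With `f` itself a plateau
one side disappears, and the other says that `dθ` contracted with `η` is zero
(`sum_mul_pd_form_sub`). Since `η` is invertible, `θ` is closed.

By the Poincaré lemma on the convex set `V`, `θ` has a potential `Φ^{ij}`. Skew-symmetry gives `∂_k
g^{ij} = b^{ij}_k + b^{ji}_k` and `g^{ij} = g^{ji}`, so `Φ` can be corrected by constants to satisfy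
the formula for `g`. The density of `{Uⁱ, Uʲ}₁` is then a total derivative. Finally, symmetry of
`b^{ij}_k η^{km}` makes `η⁻¹ Φ` closed in its first index, which yields the functions `Hʲ`. -/

theorem fderiv_apply_eq_sum_pd {N : ℕ} (f : Vec N → ℝ) (u v : Vec N) :
    fderiv ℝ f u v = ∑ k, pd k f u * v k := by
  conv_lhs => rw [← Finset.univ_sum_single v, map_sum]
  refine Finset.sum_congr rfl fun k _ => ?_
  have : (Pi.single k (v k) : Vec N) = v k • Pi.single k 1 := by
    rw [← Pi.single_smul]; simp
  rw [this, map_smul, pd, smul_eq_mul, mul_comm]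

theorem ContDiffAt.pd {N : ℕ} {f : Vec N → ℝ} {u : Vec N} (hf : ContDiffAt ℝ ∞ f u) (k : Fin N) :
    ContDiffAt ℝ ∞ (HydroBracket.pd k f) u :=
  (hf.fderiv_right (m := ∞) (by simp)).clm_apply contDiffAt_const

theorem ContDiff.pd {N : ℕ} {f : Vec N → ℝ} (hf : ContDiff ℝ ∞ f) (k : Fin N) :
    ContDiff ℝ ∞ (HydroBracket.pd k f) :=
  contDiff_iff_contDiffAt.2 fun _ => ContDiffAt.pd hf.contDiffAt k

theorem pd_congr_of_eventuallyEq {N : ℕ} {f g : Vec N → ℝ} {u : Vec N}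
    (h : f =ᶠ[nhds u] g) (k : Fin N) : pd k f u = pd k g u := by
  rw [pd, pd, h.fderiv_eq]

theorem hasDerivAt_comp_pd {N : ℕ} {f : Vec N → ℝ} {γ : ℝ → Vec N} {γ' : Vec N} {x : ℝ}
    (hf : DifferentiableAt ℝ f (γ x)) (hγ : HasDerivAt γ γ' x) :
    HasDerivAt (fun y => f (γ y)) (∑ k, pd k f (γ x) * γ' k) x := by
  rw [← fderiv_apply_eq_sum_pd]
  exact hf.hasFDerivAt.comp_hasDerivAt x hγ

theorem deriv_pi_apply {N : ℕ} {γ : ℝ → Vec N} {x : ℝ} (hγ : DifferentiableAt ℝ γ x) (k : Fin N) :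
    deriv (fun y => γ y k) x = deriv γ x k :=
  (hasDerivAt_pi.1 hγ.hasDerivAt k).deriv

theorem deriv_comp_pd {N : ℕ} {f : Vec N → ℝ} {γ : ℝ → Vec N} {x : ℝ}
    (hf : DifferentiableAt ℝ f (γ x)) (hγ : DifferentiableAt ℝ γ x) :
    deriv (fun y => f (γ y)) x = ∑ k, pd k f (γ x) * deriv (fun y => γ y k) x := by
  simp only [deriv_pi_apply hγ]
  exact (hasDerivAt_comp_pd hf hγ.hasDerivAt).deriv

theorem pd_comp {N M : ℕ} {f : Vec N → ℝ} {Ψ : Vec M → Vec N} {u : Vec M}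
    (hf : DifferentiableAt ℝ f (Ψ u)) (hΨ : DifferentiableAt ℝ Ψ u) (k : Fin M) :
    pd k (fun v => f (Ψ v)) u = ∑ c, pd c f (Ψ u) * pd k (fun v => Ψ v c) u := by
  have h := (hf.hasFDerivAt.comp u hΨ.hasFDerivAt).fderiv
  have e : pd k (fun v => f (Ψ v)) u = fderiv ℝ f (Ψ u) (fderiv ℝ Ψ u (Pi.single k 1)) := by
    rw [pd]; exact congrArg (fun L => L (Pi.single k 1)) h
  rw [e, fderiv_apply_eq_sum_pd]
  refine Finset.sum_congr rfl fun c _ => ?_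
  have h2 : fderiv ℝ (fun v => Ψ v c) u = (ContinuousLinearMap.proj c).comp (fderiv ℝ Ψ u) :=
    (hasFDerivAt_pi'.1 hΨ.hasFDerivAt c).fderiv
  rw [pd, pd, h2]
  rfl

theorem pd_apply {N : ℕ} (u : Vec N) (k c : Fin N) :
    pd k (fun v : Vec N => v c) u = if c = k then 1 else 0 := by
  have : fderiv ℝ (fun v : Vec N => v c) u = ContinuousLinearMap.proj c :=
    (ContinuousLinearMap.proj (R := ℝ) (φ := fun _ : Fin N => ℝ) c).fderiv
  simp [pd, this, Pi.single_apply]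

/-! ### Cut-off functions -/

theorem exists_plateau (R : ℝ) : ∃ χ : ℝ → ℝ, ContDiff ℝ ∞ χ ∧ HasCompactSupport χ ∧
    (∀ x, |x| ≤ R → χ x = 1) ∧ (∀ x, |R| + 2 ≤ |x| → χ x = 0) := by
  -- `|R|` keeps both radii positive; for negative `R` the plateau condition is vacuous.
  let b : ContDiffBump (0 : ℝ) := ⟨|R| + 1, |R| + 2, by positivity, by linarith⟩
  refine ⟨b, b.contDiff, b.hasCompactSupport, fun x hx => b.one_of_mem_closedBall ?_,
    fun x hx => b.zero_of_le_dist ?_⟩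
  · simp only [Metric.mem_closedBall, Real.dist_eq, sub_zero]
    have := le_abs_self R
    show |x| ≤ |R| + 1
    linarith
  · simpa [Real.dist_eq] using hx

/-- Multiplication by a bump function. Functionals have to make sense on all fields in `Ω`, whereas
coordinates exist only locally; this supplies global densities with the germ of a coordinate. -/
theorem exists_contDiff_eventuallyEq {N : ℕ} {S : Set (Vec N)} (hS : IsOpen S) {f : Vec N → ℝ}
    (hf : ∀ u ∈ S, ContDiffAt ℝ ∞ f u) {u₀ : Vec N} (hu₀ : u₀ ∈ S) :
    ∃ h : Vec N → ℝ, ContDiff ℝ ∞ h ∧ h =ᶠ[nhds u₀] f := by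
  obtain ⟨r, hr, hrS⟩ := Metric.isOpen_iff.1 hS u₀ hu₀
  let b : ContDiffBump u₀ := ⟨r / 4, r / 2, by positivity, by linarith⟩
  refine ⟨fun u => b u * f u, ?_, ?_⟩
  · refine contDiff_iff_contDiffAt.2 fun u => ?_
    by_cases hu : u ∈ S
    · exact b.contDiff.contDiffAt.mul (hf u hu)
    · have hu' : u ∉ tsupport b := by
        rw [b.tsupport_eq]
        intro h
        exact hu (hrS (Metric.closedBall_subset_ball (by show r / 2 < r; linarith) h))
      have : (fun u => b u * f u) =ᶠ[nhds u] fun _ => 0 := by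
        have := notMem_tsupport_iff_eventuallyEq.1 hu'
        filter_upwards [this] with y hy
        simp [hy]
      exact contDiffAt_const.congr_of_eventuallyEq this
  · filter_upwards [b.eventuallyEq_one] with u hu
    simp [hu]

/-! ### Integrals -/

theorem eq_zero_of_le_abs_of_hasCompactSupport {E : Type*} [Zero E] {f : ℝ → E}
    (hf : HasCompactSupport f) : ∃ R, 0 < R ∧ ∀ x, R ≤ |x| → f x = 0 := by
  obtain ⟨R, hR⟩ := (hf.isCompact.isBounded).subset_ball 0
  refine ⟨max R 1, by positivity, fun x hx => ?_⟩
  by_contra h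
  have := hR (subset_tsupport f h)
  simp only [Metric.mem_ball, Real.dist_eq, sub_zero] at this
  exact absurd (le_max_left R 1) (by linarith)

theorem hasCompactSupport_of_eq_zero {E : Type*} [Zero E] {f : ℝ → E} {R : ℝ}
    (hf : ∀ x, R ≤ |x| → f x = 0) : HasCompactSupport f := by
  refine HasCompactSupport.intro (isCompact_Icc (a := -R) (b := R)) fun x hx => hf x ?_
  by_contra h
  exact hx (Set.mem_Icc.2 (abs_le.1 (le_of_not_ge h)))

/-- Joint smoothness bounds the `ε`-derivative on the compact set `|ε| ≤ δ/2`, `|x| ≤ R`, and the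
integrand vanishes beyond `R`, so domination is automatic. Smoothness is asked only for small `ε`
because perturbed fields leave the coordinate domain for large `ε`. -/
theorem hasDerivAt_integral_of_contDiffAt {Q : ℝ → ℝ → ℝ} {δ R : ℝ} (hδ : 0 < δ)
    (hQ : ∀ ε x, |ε| < δ → ContDiffAt ℝ ∞ (fun p : ℝ × ℝ => Q p.1 p.2) (ε, x))
    (hR : ∀ ε x, |ε| < δ → R ≤ |x| → Q ε x = 0) :
    HasDerivAt (fun ε => ∫ x, Q ε x) (∫ x, deriv (fun ε => Q ε x) 0) 0 := by
  have hδ2 : ∀ ε ∈ Metric.closedBall (0 : ℝ) (δ / 2), |ε| < δ := by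
    intro ε hε
    simp only [Metric.mem_closedBall, Real.dist_eq, sub_zero] at hε
    linarith
  have hslice : ∀ ε x, |ε| < δ → HasDerivAt (fun ε => Q ε x)
      (fderiv ℝ (fun p : ℝ × ℝ => Q p.1 p.2) (ε, x) (1, 0)) ε := by
    intro ε x hε
    have h1 : HasDerivAt (fun ε : ℝ => (ε, x)) ((1 : ℝ), (0 : ℝ)) ε :=
      (hasDerivAt_id ε).prodMk (hasDerivAt_const ε x)
    exact (((hQ ε x hε).differentiableAt (by simp)).hasFDerivAt (x := (ε, x))).comp_hasDerivAt
      (f := fun ε : ℝ => (ε, x)) ε h1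
  have hQc : ∀ ε, |ε| < δ → Continuous (Q ε) := by
    intro ε hε
    refine continuous_iff_continuousAt.2 fun x => ?_
    exact ContinuousAt.comp (f := fun x : ℝ => (ε, x)) (g := fun p : ℝ × ℝ => Q p.1 p.2)
      (hQ ε x hε).continuousAt (by fun_prop)
  have hcont : ContinuousOn
      (fun p : ℝ × ℝ => fderiv ℝ (fun p : ℝ × ℝ => Q p.1 p.2) p (1, 0))
      (Metric.closedBall (0 : ℝ) (δ / 2) ×ˢ Set.Icc (-R) R) := by
    rintro ⟨ε, x⟩ ⟨hε, -⟩
    exact (((hQ ε x (hδ2 ε hε)).fderiv_right (m := ∞) (by simp)).clm_apply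
      contDiffAt_const).continuousAt.continuousWithinAt
  obtain ⟨M, hM⟩ := ((isCompact_closedBall (0 : ℝ) (δ / 2)).prod
    (isCompact_Icc (a := -R) (b := R))).exists_bound_of_continuousOn hcont
  have hder : ∀ ε x, |ε| < δ → deriv (fun ε => Q ε x) ε
      = fderiv ℝ (fun p : ℝ × ℝ => Q p.1 p.2) (ε, x) (1, 0) := fun ε x hε => (hslice ε x hε).deriv
  have key := hasDerivAt_integral_of_dominated_loc_of_deriv_le
    (μ := volume) (F := Q) (x₀ := 0) (s := Metric.closedBall (0 : ℝ) (δ / 2))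
    (F' := fun ε x => deriv (fun ε => Q ε x) ε)
    (bound := (Set.Icc (-R) R).indicator fun _ => M)
    (Metric.closedBall_mem_nhds _ (by positivity)) ?_ ?_ ?_ ?_ ?_ ?_
  · exact key.2
  · filter_upwards [Metric.closedBall_mem_nhds (0 : ℝ) (half_pos hδ)] with ε hε
    exact (hQc ε (hδ2 ε hε)).aestronglyMeasurable
  · exact (hQc 0 (by simpa)).integrable_of_hasCompactSupport
      (hasCompactSupport_of_eq_zero fun x hx => hR 0 x (by simpa) hx)
  · have : (fun x => deriv (fun ε => Q ε x) 0)
        = fun x => fderiv ℝ (fun p : ℝ × ℝ => Q p.1 p.2) (0, x) (1, 0) := by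
      funext x; exact hder 0 x (by simpa)
    rw [this]
    refine Continuous.aestronglyMeasurable (continuous_iff_continuousAt.2 fun x => ?_)
    have h := (((hQ 0 x (by simpa)).fderiv_right (m := ∞) (by simp)).clm_apply
      (contDiffAt_const (c := ((1 : ℝ), (0 : ℝ))))).continuousAt
    exact ContinuousAt.comp (f := fun x : ℝ => ((0 : ℝ), x))
      (g := fun p : ℝ × ℝ => fderiv ℝ (fun p : ℝ × ℝ => Q p.1 p.2) p (1, 0)) h (by fun_prop)
  · refine Filter.Eventually.of_forall fun x ε hε => ?_
    by_cases hx : x ∈ Set.Icc (-R) R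
    · rw [Set.indicator_of_mem hx, hder ε x (hδ2 ε hε)]
      exact hM (ε, x) ⟨hε, hx⟩
    · rw [Set.indicator_of_notMem hx]
      have hx' : R ≤ |x| := by
        by_contra h
        exact hx (Set.mem_Icc.2 (abs_le.1 (le_of_not_ge h)))
      have : (fun ε => Q ε x) =ᶠ[nhds ε] fun _ => 0 := by
        have : {ε : ℝ | |ε| < δ} ∈ nhds ε :=
          (isOpen_lt continuous_abs continuous_const).mem_nhds (hδ2 ε hε)
        filter_upwards [this] with ε' hε'
        exact hR ε' x hε' hx'
      rw [this.deriv_eq]; simp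
  · exact (integrableOn_const (by simp) (by simp)).integrable_indicator measurableSet_Icc
  · refine Filter.Eventually.of_forall fun x ε hε => ?_
    rw [hder ε x (hδ2 ε hε)]
    exact hslice ε x (hδ2 ε hε)

theorem integral_deriv_eq_zero_of_const {F : ℝ → ℝ} (hF : ContDiff ℝ ∞ F) {R c : ℝ}
    (hc : ∀ x, R ≤ |x| → F x = c) : ∫ x, deriv F x = 0 := by
  have h0 : HasCompactSupport fun x => F x - c :=
    hasCompactSupport_of_eq_zero (R := R) fun x hx => by rw [hc x hx, sub_self]
  have hd : deriv F = deriv fun x => F x - c := by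
    funext x; rw [deriv_sub_const]
  have hcd : ContDiff ℝ 1 fun x => F x - c := (hF.sub contDiff_const).of_le (by simp)
  rw [hd]
  have h1 := HasCompactSupport.integral_Iic_deriv_eq hcd h0 0
  have h2 := HasCompactSupport.integral_Ioi_deriv_eq hcd h0 0
  have hi : Integrable (deriv fun x => F x - c) :=
    (hcd.continuous_deriv le_rfl).integrable_of_hasCompactSupport h0.deriv
  rw [← intervalIntegral.integral_Iic_add_Ioi hi.integrableOn hi.integrableOn (b := 0), h1, h2]
  ring

theorem integral_mul_deriv_eq_neg {p q : ℝ → ℝ} (hp : ContDiff ℝ ∞ p) (hq : ContDiff ℝ ∞ q)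
    (hc : HasCompactSupport p ∨ HasCompactSupport q) :
    ∫ x, p x * deriv q x = -∫ x, deriv p x * q x := by
  have hp1 : Continuous (deriv p) := hp.continuous_deriv (by simp)
  have hq1 : Continuous (deriv q) := hq.continuous_deriv (by simp)
  refine integral_mul_deriv_eq_deriv_mul_of_integrable
    (fun x _ => (hp.differentiable (by simp) x).hasDerivAt)
    (fun x _ => (hq.differentiable (by simp) x).hasDerivAt) ?_ ?_ ?_
  · refine (hp.continuous.mul hq1).integrable_of_hasCompactSupport ?_
    rcases hc with h | h
    exacts [h.mul_right, h.deriv.mul_left]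
  · refine (hp1.mul hq.continuous).integrable_of_hasCompactSupport ?_
    rcases hc with h | h
    exacts [h.deriv.mul_right, h.mul_left]
  · refine (hp.continuous.mul hq.continuous).integrable_of_hasCompactSupport ?_
    rcases hc with h | h
    exacts [h.mul_right, h.mul_left]

theorem eq_zero_of_forall_integral_mul_eq_zero {X : ℝ → ℝ} (hX : Continuous X)
    (h : ∀ l : ℝ → ℝ, ContDiff ℝ ∞ l → HasCompactSupport l → ∫ x, l x * X x = 0) : X = 0 := by
  have hae : ∀ᵐ x ∂(volume : Measure ℝ), X x = 0 :=
    ae_eq_zero_of_integral_contDiff_smul_eq_zero hX.locallyIntegrable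
      fun g hg hgs => by simpa using h g hg hgs
  exact Measure.eq_of_ae_eq hae hX continuous_const

/-- Integration by parts gives `X' = 0`, and compact support fixes the constant. The test function
`l` enters the flows only through `l'`, so this weaker test is the one available. -/
theorem eq_zero_of_forall_integral_deriv_mul_eq_zero {X : ℝ → ℝ} (hX : ContDiff ℝ ∞ X)
    (hXc : HasCompactSupport X)
    (h : ∀ l : ℝ → ℝ, ContDiff ℝ ∞ l → HasCompactSupport l → ∫ x, deriv l x * X x = 0) :
    X = 0 := by
  have hd : deriv X = 0 := by
    refine eq_zero_of_forall_integral_mul_eq_zero (hX.continuous_deriv (by simp)) fun l hl hlc => ?_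
    rw [integral_mul_deriv_eq_neg hl hX (Or.inl hlc), h l hl hlc, neg_zero]
  obtain ⟨R, -, hR⟩ := eq_zero_of_le_abs_of_hasCompactSupport hXc
  funext x
  rw [is_const_of_deriv_eq_zero (hX.differentiable (by simp)) (fun x => congrFun hd x) x R]
  exact hR R (le_abs_self R)

/-! ### The operator `(d/dx)⁻¹` -/

theorem dinv_eq {q : ℝ → ℝ} (hq : Integrable q) (x : ℝ) :
    dinv q x = (∫ y in Set.Iic x, q y) - (1 / 2) * ∫ y, q y := by
  rw [dinv, ← intervalIntegral.integral_Iic_add_Ioi hq.integrableOn hq.integrableOn (b := x)]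
  ring

/-- `dinv q` differs from `∫₀ˣ q` by a constant. -/
theorem hasDerivAt_dinv {q : ℝ → ℝ} (hq : Continuous q) (hqc : HasCompactSupport q) (x : ℝ) :
    HasDerivAt (dinv q) (q x) x := by
  have hi := hq.integrable_of_hasCompactSupport hqc (μ := volume)
  have e : dinv q = fun x => (∫ y in (0 : ℝ)..x, q y)
      + ((∫ y in Set.Iic 0, q y) - (1 / 2) * ∫ y, q y) := by
    funext x
    rw [dinv_eq hi, ← intervalIntegral.integral_Iic_sub_Iic hi.integrableOn hi.integrableOn]
    ring
  rw [e]
  exact (intervalIntegral.integral_hasDerivAt_right (hq.intervalIntegrable _ _)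
    (hq.stronglyMeasurableAtFilter _ _) hq.continuousAt).add_const _

theorem continuous_dinv {q : ℝ → ℝ} (hq : Continuous q) (hqc : HasCompactSupport q) :
    Continuous (dinv q) :=
  continuous_iff_continuousAt.2 fun x => (hasDerivAt_dinv hq hqc x).continuousAt

/-- The two half-line integrals of `F'` are `F x - c` and `c - F x`, and the factor ½ averages them.
This is where the value of the field at infinity enters the nonlocal term. -/
theorem dinv_deriv {F : ℝ → ℝ} (hF : ContDiff ℝ ∞ F) {R c : ℝ}
    (hc : ∀ x, R ≤ |x| → F x = c) (x : ℝ) : dinv (deriv F) x = F x - c := by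
  have h0 : HasCompactSupport fun x => F x - c :=
    hasCompactSupport_of_eq_zero (R := R) fun x hx => by rw [hc x hx, sub_self]
  have hd : deriv F = deriv fun x => F x - c := by
    funext x; rw [deriv_sub_const]
  have hcd : ContDiff ℝ 1 fun x => F x - c := (hF.sub contDiff_const).of_le (by simp)
  rw [dinv, hd, HasCompactSupport.integral_Iic_deriv_eq hcd h0,
    HasCompactSupport.integral_Ioi_deriv_eq hcd h0]
  ring

/-- `dinv q` need not decay, but `p - c` has compact support, so integrating by parts leaves no
boundary term. -/
theorem integral_deriv_mul_dinv {p q : ℝ → ℝ} (hp : ContDiff ℝ ∞ p) {R c : ℝ}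
    (hpc : ∀ x, R ≤ |x| → p x = c)
    (hq : Continuous q) (hqc : HasCompactSupport q) :
    ∫ x, deriv p x * dinv q x = -∫ x, (p x - c) * q x := by
  have h0 : HasCompactSupport fun x => p x - c :=
    hasCompactSupport_of_eq_zero (R := R) fun x hx => by rw [hpc x hx, sub_self]
  have hcd : ContDiff ℝ 1 fun x => p x - c := (hp.sub contDiff_const).of_le (by simp)
  have hd : ∀ x, deriv p x = deriv (fun x => p x - c) x := fun x => by rw [deriv_sub_const]
  have hd1 : Continuous (deriv fun x => p x - c) := hcd.continuous_deriv le_rfl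
  have hD := continuous_dinv hq hqc
  simp only [hd]
  have h := integral_mul_deriv_eq_deriv_mul_of_integrable
    (u := fun x => p x - c) (v := dinv q)
    (fun x _ => (hcd.differentiable (by simp) x).hasDerivAt)
    (fun x _ => hasDerivAt_dinv hq hqc x)
    ((hcd.continuous.mul hq).integrable_of_hasCompactSupport h0.mul_right)
    ((hd1.mul hD).integrable_of_hasCompactSupport h0.deriv.mul_right)
    ((hcd.continuous.mul hD).integrable_of_hasCompactSupport h0.mul_right)
  rw [h, neg_neg]

/-! ### Fields, functionals and their variational derivatives -/

variable {N : ℕ}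

theorem contDiff_comp_of_contDiffAt {E F G : Type*} [NormedAddCommGroup E] [NormedSpace ℝ E]
    [NormedAddCommGroup F] [NormedSpace ℝ F] [NormedAddCommGroup G] [NormedSpace ℝ G]
    {f : F → G} {w : E → F} (hf : ∀ x, ContDiffAt ℝ ∞ f (w x)) (hw : ContDiff ℝ ∞ w) :
    ContDiff ℝ ∞ fun x => f (w x) :=
  contDiff_iff_contDiffAt.2 fun x => (hf x).comp x hw.contDiffAt

theorem contDiff_deriv {f : ℝ → ℝ} (hf : ContDiff ℝ ∞ f) : ContDiff ℝ ∞ (deriv f) :=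
  (contDiff_infty_iff_deriv.1 hf).2

theorem deriv_eq_zero_of_const {E : Type*} [NormedAddCommGroup E] [NormedSpace ℝ E]
    {f : ℝ → E} {R : ℝ} {c : E} (hf : ∀ x, R ≤ |x| → f x = c)
    {x : ℝ} (hx : R < |x|) : deriv f x = 0 := by
  have : f =ᶠ[nhds x] fun _ => c := by
    filter_upwards [(isOpen_lt continuous_const continuous_abs).mem_nhds hx] with y hy
    exact hf y (le_of_lt hy)
  rw [this.deriv_eq, deriv_const]

theorem IsField.exists_const {Ω : Set (Vec N)} {w : ℝ → Vec N} (hw : IsField Ω w) :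
    ∃ (c : Vec N) (R : ℝ), 0 < R ∧ c ∈ Ω ∧ ∀ x, R ≤ |x| → w x = c := by
  obtain ⟨-, hΩ, c, hc⟩ := hw
  obtain ⟨R, hR, h⟩ := eq_zero_of_le_abs_of_hasCompactSupport hc
  have h' : ∀ x, R ≤ |x| → w x = c := fun x hx => sub_eq_zero.1 (h x hx)
  exact ⟨c, R, hR, h' R (le_abs_self R) ▸ hΩ R, h'⟩

theorem IsField.mono {Ω Ω' : Set (Vec N)} {w : ℝ → Vec N} (hw : IsField Ω w) (h : Ω ⊆ Ω') :
    IsField Ω' w :=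
  ⟨hw.1, fun x => h (hw.2.1 x), hw.2.2⟩

theorem IsField.of_const {Ω : Set (Vec N)} {w : ℝ → Vec N} (hw : ContDiff ℝ ∞ w)
    (hΩ : ∀ x, w x ∈ Ω) {c : Vec N} {R : ℝ} (hc : ∀ x, R ≤ |x| → w x = c) : IsField Ω w :=
  ⟨hw, hΩ, c, hasCompactSupport_of_eq_zero fun x hx => sub_eq_zero.2 (hc x hx)⟩

/-- The range of a field, including its value at infinity, lies in a compact subset of `W`, which
has a uniform neighbourhood inside `W`. -/
theorem IsField.exists_isField_add_smul {W : Set (Vec N)} (hW : IsOpen W) {w v : ℝ → Vec N}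
    (hw : IsField W w) (hv : ContDiff ℝ ∞ v) (hvc : HasCompactSupport v) :
    ∃ δ > 0, ∀ ε : ℝ, |ε| < δ → IsField W (w + ε • v) := by
  obtain ⟨c, R, hR, hcW, hc⟩ := hw.exists_const
  obtain ⟨R', hR', hv0⟩ := eq_zero_of_le_abs_of_hasCompactSupport hvc
  have hK : IsCompact (w '' Set.Icc (-R) R) := isCompact_Icc.image hw.1.continuous
  have hKW : w '' Set.Icc (-R) R ⊆ W := by
    rintro _ ⟨x, -, rfl⟩
    exact hw.2.1 x
  obtain ⟨r, hr, hrW⟩ := (hK.union (isCompact_singleton (x := c))).exists_thickening_subset_open hW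
    (Set.union_subset hKW (Set.singleton_subset_iff.2 hcW))
  obtain ⟨M, hM⟩ := hvc.exists_bound_of_continuous hv.continuous
  have hM0 : 0 ≤ M := (norm_nonneg _).trans (hM 0)
  refine ⟨r / (M + 1), by positivity, fun ε hε => ?_⟩
  refine IsField.of_const (hw.1.add (contDiff_const.smul hv)) (fun x => hrW ?_)
    (c := c) (R := max R R') fun x hx => ?_
  · rw [Metric.mem_thickening_iff]
    refine ⟨w x, ?_, ?_⟩
    · by_cases hx : x ∈ Set.Icc (-R) R
      · exact Or.inl ⟨x, hx, rfl⟩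
      · refine Or.inr (hc x ?_)
        by_contra h
        exact hx (Set.mem_Icc.2 (abs_le.1 (le_of_not_ge h)))
    · rw [dist_eq_norm]
      simp only [Pi.add_apply, Pi.smul_apply, add_sub_cancel_left, norm_smul, Real.norm_eq_abs]
      calc |ε| * ‖v x‖ ≤ |ε| * (M + 1) := by gcongr; linarith [hM x]
        _ < r / (M + 1) * (M + 1) := by gcongr
        _ = r := by field_simp
  · simp [hc x ((le_max_left _ _).trans hx), hv0 x ((le_max_right _ _).trans hx)]

/-- The functional `∫ f(x) h(w(x)) dx`. -/
noncomputable def locFun (f : ℝ → ℝ) (h : Vec N → ℝ) (w : ℝ → Vec N) : ℝ :=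
  ∫ x, f x * h (w x)

theorem isVarDeriv_locFun {f : ℝ → ℝ} (hf : ContDiff ℝ ∞ f) (hfc : HasCompactSupport f)
    {h : Vec N → ℝ} (hh : ContDiff ℝ ∞ h) {w : ℝ → Vec N} (hw : ContDiff ℝ ∞ w) :
    IsVarDeriv (locFun f h) w fun x i => f x * pd i h (w x) := by
  refine ⟨contDiff_pi.2 fun i => hf.mul ((ContDiff.pd hh i).comp hw), fun v hv hvc => ?_⟩
  obtain ⟨R, hR, hfR⟩ := eq_zero_of_le_abs_of_hasCompactSupport hfc
  have key := hasDerivAt_integral_of_contDiffAt (Q := fun ε x => f x * h (w x + ε • v x))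
    (δ := 1) (R := R) one_pos
    (fun ε x _ => by
      have : ContDiff ℝ ∞ fun p : ℝ × ℝ => f p.2 * h (w p.2 + p.1 • v p.2) := by fun_prop
      exact this.contDiffAt)
    (fun _ x _ hx => by simp [hfR x hx])
  change HasDerivAt (fun ε : ℝ => ∫ x, f x * h (w x + ε • v x)) _ 0
  convert key using 1
  refine integral_congr_ae (Filter.Eventually.of_forall fun x => ?_)
  have h1 : HasDerivAt (fun ε : ℝ => w x + ε • v x) (v x) 0 := by
    simpa using ((hasDerivAt_id (0 : ℝ)).smul_const (v x)).const_add (w x)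
  have h2 := (hasDerivAt_comp_pd (f := h) (x := 0)
    (hh.differentiable (by simp) _) h1).const_mul (f x)
  simp only [zero_smul, add_zero] at h2
  show _ = deriv (fun ε => f x * h (w x + ε • v x)) 0
  rw [h2.deriv, Finset.mul_sum]
  exact Finset.sum_congr rfl fun i _ => by ring

theorem isFunctional_locFun {f : ℝ → ℝ} (hf : ContDiff ℝ ∞ f) (hfc : HasCompactSupport f)
    {h : Vec N → ℝ} (hh : ContDiff ℝ ∞ h) (Ω : Set (Vec N)) : IsFunctional Ω (locFun f h) := by
  refine ⟨fun w hw => ⟨_, isVarDeriv_locFun hf hfc hh hw.1⟩, fun n U hU => ?_⟩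
  have hUp : ∀ p, ContDiff ℝ ∞ (U p) := fun p =>
    hU.1.comp (contDiff_const.prodMk contDiff_id)
  have e : ∀ p, varDeriv (locFun f h) (U p) = fun x i => f x * pd i h (U p x) := fun p =>
    (isVarDeriv_locFun hf hfc hh (hUp p)).varDeriv_eq
  obtain ⟨R, hR, hfR⟩ := eq_zero_of_le_abs_of_hasCompactSupport hfc
  refine ⟨?_, fun S _ => ⟨R, fun p _ => ⟨0, fun x hx => ?_⟩⟩⟩
  · simp only [e]
    exact contDiff_pi.2 fun i => (hf.comp contDiff_snd).mul ((ContDiff.pd hh i).comp hU.1)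
  · rw [e]; funext i; simp [hfR x hx]

theorem IsFunctional.isVarDeriv_varDeriv {Ω : Set (Vec N)} {I : (ℝ → Vec N) → ℝ}
    (hI : IsFunctional Ω I) {w : ℝ → Vec N} (hw : IsField Ω w) :
    IsVarDeriv I w (varDeriv I w) := by
  obtain ⟨a, ha⟩ := hI.1 w hw
  rwa [ha.varDeriv_eq]

theorem IsFunctional.exists_const {Ω : Set (Vec N)} {I : (ℝ → Vec N) → ℝ}
    (hI : IsFunctional Ω I) {w : ℝ → Vec N} (hw : IsField Ω w) :
    ∃ (R : ℝ) (d : Vec N), ∀ x, R ≤ |x| → varDeriv I w x = d := by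
  obtain ⟨c, R, -, -, hc⟩ := hw.exists_const
  -- A single field is a family over the one-point space `Vec 0`.
  have hU : IsFamily (n := 0) Ω fun _ => w :=
    ⟨hw.1.comp contDiff_snd, fun _ x => hw.2.1 x, c, fun S _ => ⟨R, fun _ _ x hx => hc x hx⟩⟩
  obtain ⟨R', hR'⟩ := (hI.2 0 _ hU).2 Set.univ isCompact_univ
  obtain ⟨d, hd⟩ := hR' 0 trivial
  exact ⟨R', d, hd⟩

/-- A compactly supported variation does not move the value at infinity, so the normalization is a
constant and drops out on differentiation. -/
theorem isVarDeriv_coordFunctional {W : Set (Vec N)} (hW : IsOpen W) {φ : Vec N → Vec N}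
    (i : Fin N) (hφ : ∀ u ∈ W, ContDiffAt ℝ ∞ (fun u => φ u i) u) {w : ℝ → Vec N}
    (hw : IsField W w) :
    IsVarDeriv (coordFunctional φ i) w fun x k => pd k (fun u => φ u i) (w x) := by
  refine ⟨contDiff_pi.2 fun k =>
    contDiff_comp_of_contDiffAt (fun x => ContDiffAt.pd (hφ _ (hw.2.1 x)) k) hw.1,
    fun v hv hvc => ?_⟩
  obtain ⟨c, R, hR, -, hc⟩ := hw.exists_const
  obtain ⟨R', hR', hv0⟩ := eq_zero_of_le_abs_of_hasCompactSupport hvc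
  obtain ⟨δ, hδ, hfld⟩ := hw.exists_isField_add_smul hW hv hvc
  have hc' : ∀ (ε x : ℝ), max R R' ≤ |x| → w x + ε • v x = c := fun ε x hx => by
    simp [hc x ((le_max_left _ _).trans hx), hv0 x ((le_max_right _ _).trans hx)]
  have hlim : ∀ ε : ℝ, Filter.limUnder Filter.atTop (w + ε • v) = c := by
    intro ε
    refine Filter.Tendsto.limUnder_eq ?_
    refine tendsto_const_nhds.congr' ?_
    filter_upwards [Filter.eventually_ge_atTop (max R R')] with x hx
    exact (hc' ε x (hx.trans (le_abs_self x))).symm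
  have hmem : ∀ ε x, |ε| < δ → w x + ε • v x ∈ W := fun ε x hε => (hfld ε hε).2.1 x
  have key := hasDerivAt_integral_of_contDiffAt
    (Q := fun ε x => φ (w x + ε • v x) i - φ c i) (δ := δ) (R := max R R') hδ
    (fun ε x hε => by
      have hw' := hw.1
      have h1 : ContDiff ℝ ∞ fun p : ℝ × ℝ => w p.2 + p.1 • v p.2 := by fun_prop
      exact (ContDiffAt.comp (f := fun p : ℝ × ℝ => w p.2 + p.1 • v p.2)
        (g := fun u => φ u i) (ε, x) (hφ _ (hmem ε x hε)) h1.contDiffAt).sub contDiffAt_const)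
    (fun ε x _ hx => by rw [hc' ε x hx, sub_self])
  have e : (fun ε : ℝ => coordFunctional φ i (w + ε • v))
      = fun ε => ∫ x, (φ (w x + ε • v x) i - φ c i) := by
    funext ε
    rw [coordFunctional, hlim]
    rfl
  rw [e]
  convert key using 1
  refine integral_congr_ae (Filter.Eventually.of_forall fun x => ?_)
  have h1 : HasDerivAt (fun ε : ℝ => w x + ε • v x) (v x) 0 := by
    simpa using ((hasDerivAt_id (0 : ℝ)).smul_const (v x)).const_add (w x)
  have h2 := (hasDerivAt_comp_pd (f := fun u => φ u i) (x := 0)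
    ((hφ _ (hmem 0 x (by simpa))).differentiableAt (by simp)) h1).sub_const (φ c i)
  simp only [zero_smul, add_zero] at h2
  exact h2.deriv.symm

/-! ### The operator of a bracket -/

namespace Bracket

theorem lin_one_zero (B C : Bracket N) : lin 1 0 B C = B := by
  simp [lin]

theorem op_lin (α β : ℝ) (B C : Bracket N) (u ψ : ℝ → Vec N) (x : ℝ) (i : Fin N) :
    (lin α β B C).op u ψ x i = α * B.op u ψ x i + β * C.op u ψ x i := by
  simp only [op, lin, Matrix.add_apply, Matrix.smul_apply, smul_eq_mul]
  rw [mul_add, mul_add, Finset.mul_sum, Finset.mul_sum, add_add_add_comm, ← Finset.sum_add_distrib]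
  congr 1
  · refine Finset.sum_congr rfl fun j _ => ?_
    simp only [add_mul, Finset.sum_add_distrib, mul_assoc, ← Finset.mul_sum]
    ring
  · ring

variable {B : Bracket N} {Ω : Set (Vec N)}

theorem SmoothOn.g_contDiffAt (hB : B.SmoothOn Ω) (hΩ : IsOpen Ω) {u : Vec N} (hu : u ∈ Ω)
    (i j : Fin N) : ContDiffAt ℝ ∞ (fun u => B.g u i j) u :=
  (hB.1 i j).contDiffAt (hΩ.mem_nhds hu)

theorem SmoothOn.b_contDiffAt (hB : B.SmoothOn Ω) (hΩ : IsOpen Ω) {u : Vec N} (hu : u ∈ Ω)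
    (i j k : Fin N) : ContDiffAt ℝ ∞ (fun u => B.b u i j k) u :=
  (hB.2 i j k).contDiffAt (hΩ.mem_nhds hu)

theorem contDiff_local_part (hB : B.SmoothOn Ω) (hΩ : IsOpen Ω) {w ψ : ℝ → Vec N}
    (hw : IsField Ω w) (hψ : ContDiff ℝ ∞ ψ) (i : Fin N) :
    ContDiff ℝ ∞ fun x => ∑ j, (B.g (w x) i j * deriv (fun y => ψ y j) x
      + (∑ k, B.b (w x) i j k * deriv (fun y => w y k) x) * ψ x j) := by
  have hψj := contDiff_pi.1 hψ
  have hwk := contDiff_pi.1 hw.1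
  refine ContDiff.sum fun j _ => ContDiff.add (ContDiff.mul ?_ (contDiff_deriv (hψj j)))
    (ContDiff.mul (ContDiff.sum fun k _ => ContDiff.mul ?_ (contDiff_deriv (hwk k))) (hψj j))
  · exact contDiff_comp_of_contDiffAt (fun x => hB.g_contDiffAt hΩ (hw.2.1 x) i j) hw.1
  · exact contDiff_comp_of_contDiffAt (fun x => hB.b_contDiffAt hΩ (hw.2.1 x) i j k) hw.1

/-- Variational derivatives are tested on smooth compactly supported variations; this and
`hasCompactSupport_op` make the flow of a local bracket an admissible variation. -/
theorem contDiff_op_of_local (hB : B.SmoothOn Ω) (hΩ : IsOpen Ω) (hK : B.K = 0)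
    {w ψ : ℝ → Vec N} (hw : IsField Ω w) (hψ : ContDiff ℝ ∞ ψ) : ContDiff ℝ ∞ (B.op w ψ) := by
  refine contDiff_pi.2 fun i => ?_
  simp only [op, hK, zero_mul, add_zero]
  exact contDiff_local_part hB hΩ hw hψ i

theorem continuous_op (hB : B.SmoothOn Ω) (hΩ : IsOpen Ω) {w ψ : ℝ → Vec N}
    (hw : IsField Ω w) (hψ : ContDiff ℝ ∞ ψ) (i : Fin N) :
    Continuous fun x => B.op w ψ x i := by
  obtain ⟨c, R, hR, -, hc⟩ := hw.exists_const
  have hψj := contDiff_pi.1 hψ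
  have hwk := contDiff_pi.1 hw.1
  have hwd : ∀ k, Continuous (deriv fun y => w y k) := fun k => (contDiff_deriv (hwk k)).continuous
  have hws : ∀ k, ∀ x, R + 1 ≤ |x| → deriv (fun y => w y k) x = 0 := fun k x hx =>
    deriv_eq_zero_of_const (R := R) (c := c k) (fun y hy => by rw [hc y hy]) (by linarith)
  refine (contDiff_local_part hB hΩ hw hψ i).continuous.add
    (((continuous_const.mul (hwd i))).mul (continuous_dinv ?_ ?_))
  · exact continuous_finsetSum _ fun j _ => (hwd j).mul (hψj j).continuous
  · exact hasCompactSupport_of_eq_zero (R := R + 1) fun x hx =>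
      Finset.sum_eq_zero fun j _ => by rw [hws j x hx, zero_mul]

/-- Every term, the nonlocal one included, carries a factor `u_x` or `ψ_x`. -/
theorem hasCompactSupport_op {w ψ : ℝ → Vec N}
    (hw : IsField Ω w) {R : ℝ} {d : Vec N} (hψ : ∀ x, R ≤ |x| → ψ x = d) :
    HasCompactSupport (B.op w ψ) := by
  obtain ⟨c, R', hR, -, hc⟩ := hw.exists_const
  refine hasCompactSupport_of_eq_zero (R := max R R' + 1) fun x hx => ?_
  have h1 : ∀ k, deriv (fun y => w y k) x = 0 := fun k =>
    deriv_eq_zero_of_const (R := R') (c := c k) (fun y hy => by rw [hc y hy])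
      (by linarith [le_max_right R R'])
  have h2 : ∀ k, deriv (fun y => ψ y k) x = 0 := fun k =>
    deriv_eq_zero_of_const (R := R) (c := d k) (fun y hy => by rw [hψ y hy])
      (by linarith [le_max_left R R'])
  funext i
  simp [op, h1, h2]

theorem integrable_mul_op (hB : B.SmoothOn Ω) (hΩ : IsOpen Ω) {w a ψ : ℝ → Vec N}
    (hw : IsField Ω w) (ha : Continuous a) (hψ : ContDiff ℝ ∞ ψ) {R : ℝ} {d : Vec N}
    (hψd : ∀ x, R ≤ |x| → ψ x = d) :
    Integrable fun x => ∑ i, a x i * B.op w ψ x i := by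
  refine integrable_finsetSum _ fun i _ => ?_
  refine Continuous.integrable_of_hasCompactSupport
    (((continuous_apply i).comp ha).mul (continuous_op hB hΩ hw hψ i)) ?_
  have : HasCompactSupport fun x => B.op w ψ x i :=
    (hasCompactSupport_op (B := B) hw hψd).comp_left (g := fun v : Vec N => v i) rfl
  exact this.mul_left

theorem integral_mul_op_lin {B₁ B₂ : Bracket N} (h₁ : B₁.SmoothOn Ω) (h₂ : B₂.SmoothOn Ω)
    (hΩ : IsOpen Ω) {w a : ℝ → Vec N} (hw : IsField Ω w) (ha : Continuous a)
    {J : (ℝ → Vec N) → ℝ} (hJ : IsFunctional Ω J) (α β : ℝ) :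
    ∫ x, ∑ i, a x i * (lin α β B₁ B₂).op w (varDeriv J w) x i
      = α * (∫ x, ∑ i, a x i * B₁.op w (varDeriv J w) x i)
        + β * ∫ x, ∑ i, a x i * B₂.op w (varDeriv J w) x i := by
  obtain ⟨R, d, hd⟩ := hJ.exists_const hw
  have hs := (hJ.isVarDeriv_varDeriv hw).1
  rw [← integral_const_mul, ← integral_const_mul, ← integral_add
    ((integrable_mul_op h₁ hΩ hw ha hs hd).const_mul α)
    ((integrable_mul_op h₂ hΩ hw ha hs hd).const_mul β)]
  refine integral_congr_ae (Filter.Eventually.of_forall fun x => ?_)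
  simp only [op_lin, Finset.mul_sum, ← Finset.sum_add_distrib]
  exact Finset.sum_congr rfl fun i _ => by ring

theorem bracket_lin {B₁ B₂ : Bracket N} (h₁ : B₁.SmoothOn Ω) (h₂ : B₂.SmoothOn Ω)
    (hΩ : IsOpen Ω) {w : ℝ → Vec N} (hw : IsField Ω w)
    {I J : (ℝ → Vec N) → ℝ} (hI : IsFunctional Ω I) (hJ : IsFunctional Ω J) (α β : ℝ) :
    (lin α β B₁ B₂).bracket I J w = α * B₁.bracket I J w + β * B₂.bracket I J w :=
  integral_mul_op_lin h₁ h₂ hΩ hw (hI.isVarDeriv_varDeriv hw).1.continuous hJ α β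

/-- If the functional `{I, J}₂` is locally constant at `w`, then `{I, J}₁ + {I, J}₂` and
`{I, J}₁` have the same variational derivative. -/
theorem varDeriv_bracket_lin {B₁ B₂ : Bracket N} (h₁ : B₁.SmoothOn Ω) (h₂ : B₂.SmoothOn Ω)
    (hΩ : IsOpen Ω) {w : ℝ → Vec N} (hw : IsField Ω w)
    {I J : (ℝ → Vec N) → ℝ} (hI : IsFunctional Ω I) (hJ : IsFunctional Ω J)
    (hIJ : IsFunctional Ω (B₁.bracket I J))
    (hc : ∀ v, ContDiff ℝ ∞ v → HasCompactSupport v →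
      ∀ᶠ ε : ℝ in nhds 0, B₂.bracket I J (w + ε • v) = B₂.bracket I J w) :
    varDeriv ((lin 1 1 B₁ B₂).bracket I J) w = varDeriv (B₁.bracket I J) w := by
  refine IsVarDeriv.varDeriv_eq ⟨(hIJ.isVarDeriv_varDeriv hw).1, fun v hv hvc => ?_⟩
  have h := (hIJ.isVarDeriv_varDeriv hw).2 v hv hvc
  refine (h.add_const (B₂.bracket I J w)).congr_of_eventuallyEq ?_
  obtain ⟨δ, hδ, hfld⟩ := hw.exists_isField_add_smul hΩ hv hvc
  have hδn : {ε : ℝ | |ε| < δ} ∈ nhds (0 : ℝ) :=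
    (isOpen_lt continuous_abs continuous_const).mem_nhds (by simpa using hδ)
  filter_upwards [hc v hv hvc, hδn] with ε h2 hε
  rw [bracket_lin h₁ h₂ hΩ (hfld ε hε) hI hJ, h2, one_mul, one_mul]

/-- The Jacobi identity for compatible brackets, when the brackets `{·,·}₂` of the functionals are
locally constant at `w` and the second bracket is local. -/
theorem Compatible.mixed_jacobi {B₁ B₂ : Bracket N} (h₁ : B₁.SmoothOn Ω) (h₂ : B₂.SmoothOn Ω)
    (hΩ : IsOpen Ω) (hK : B₂.K = 0) (hcomp : Compatible Ω B₁ B₂) {w : ℝ → Vec N}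
    (hw : IsField Ω w) {I : Fin 3 → (ℝ → Vec N) → ℝ} (hI : ∀ p, IsFunctional Ω (I p))
    (hc : ∀ p q v, ContDiff ℝ ∞ v → HasCompactSupport v →
      ∀ᶠ ε : ℝ in nhds 0, B₂.bracket (I p) (I q) (w + ε • v) = B₂.bracket (I p) (I q) w) :
    ∃ d : Fin 3 → Fin 3 → Fin 3 → ℝ, d 0 1 2 + d 1 2 0 + d 2 0 1 = 0 ∧
      ∀ p q r, HasDerivAt (fun ε : ℝ => B₁.bracket (I p) (I q)
        (w + ε • B₂.op w (varDeriv (I r) w))) (d p q r) 0 := by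
  have hP0 : B₁.IsPoisson Ω := by simpa [lin_one_zero] using hcomp 1 0
  have hP1 := hcomp 1 1
  have hF : ∀ p q, IsFunctional Ω (B₁.bracket (I p) (I q)) := fun p q => hP0.1 _ _ (hI p) (hI q)
  -- `d p q r` is the derivative of `{I_p, I_q}₁` along the `{·,·}₂`-flow of `I_r`.
  refine ⟨fun p q r => ∫ x, ∑ i, varDeriv (B₁.bracket (I p) (I q)) w x i
    * B₂.op w (varDeriv (I r) w) x i, ?_, fun p q r => ?_⟩
  · have h0 := hP0.2.2 _ _ _ (hI 0) (hI 1) (hI 2) w hw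
    have h1 := hP1.2.2 _ _ _ (hI 0) (hI 1) (hI 2) w hw
    -- The inner `{I_p, I_q}₂` is locally constant and contributes no variational derivative.
    -- Subtracting the Jacobi identity of `B₁` then leaves the cyclic sum of the `d p q r`.
    have e : ∀ p q r, (lin 1 1 B₁ B₂).bracket ((lin 1 1 B₁ B₂).bracket (I p) (I q)) (I r) w
        = B₁.bracket (B₁.bracket (I p) (I q)) (I r) w
          + ∫ x, ∑ i, varDeriv (B₁.bracket (I p) (I q)) w x i
              * B₂.op w (varDeriv (I r) w) x i := by
      intro p q r
      rw [bracket, varDeriv_bracket_lin h₁ h₂ hΩ hw (hI p) (hI q) (hF p q) (hc p q),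
        integral_mul_op_lin h₁ h₂ hΩ hw ((hF p q).isVarDeriv_varDeriv hw).1.continuous (hI r),
        one_mul, one_mul, bracket]
    rw [e, e, e] at h1
    linarith
  · obtain ⟨R, d, hd⟩ := (hI r).exists_const hw
    exact ((hF p q).isVarDeriv_varDeriv hw).2 _
      (contDiff_op_of_local h₂ hΩ hK hw ((hI r).isVarDeriv_varDeriv hw).1)
      (hasCompactSupport_op hw hd)

end Bracket

/-! ### Changes of coordinates -/

variable {φ : OpenPartialHomeomorph (Vec N) (Vec N)}

namespace IsCoordinates

theorem contDiffAt_coe (hφ : IsCoordinates φ) {w : Vec N} (hw : w ∈ φ.source) (i : Fin N) :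
    ContDiffAt ℝ ∞ (fun w => φ w i) w :=
  contDiffAt_pi.1 (hφ.1.contDiffAt (φ.open_source.mem_nhds hw)) i

theorem contDiffAt_symm (hφ : IsCoordinates φ) {u : Vec N} (hu : u ∈ φ.target) :
    ContDiffAt ℝ ∞ φ.symm u :=
  hφ.2.contDiffAt (φ.open_target.mem_nhds hu)

theorem sum_pd_mul_pd_symm (hφ : IsCoordinates φ) {w : Vec N} (hw : w ∈ φ.source)
    (i k : Fin N) :
    ∑ c, pd c (fun w => φ w i) w * pd k (fun u => φ.symm u c) (φ w) = if i = k then 1 else 0 := by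
  have hu := φ.map_source hw
  have h1 := pd_comp (f := fun w => φ w i) (Ψ := φ.symm) (u := φ w)
    ((hφ.contDiffAt_coe (φ.map_target hu) i).differentiableAt (by simp))
    ((hφ.contDiffAt_symm hu).differentiableAt (by simp)) k
  rw [φ.left_inv hw] at h1
  rw [← h1, ← pd_apply (φ w) k i]
  refine pd_congr_of_eventuallyEq ?_ k
  filter_upwards [φ.open_target.mem_nhds hu] with y hy
  rw [φ.right_inv hy]

theorem sum_pd_symm_mul_pd (hφ : IsCoordinates φ) {w : Vec N} (hw : w ∈ φ.source)
    (c a : Fin N) :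
    ∑ k, pd k (fun u => φ.symm u c) (φ w) * pd a (fun w => φ w k) w = if c = a then 1 else 0 := by
  have hu := φ.map_source hw
  have h1 := pd_comp (f := fun u => φ.symm u c) (Ψ := φ) (u := w)
    ((contDiffAt_pi.1 (hφ.contDiffAt_symm hu) c).differentiableAt (by simp))
    ((contDiffAt_pi.2 (hφ.contDiffAt_coe hw)).differentiableAt (by simp)) a
  rw [← h1, ← pd_apply w a c]
  refine pd_congr_of_eventuallyEq ?_ a
  filter_upwards [φ.open_source.mem_nhds hw] with y hy
  rw [φ.left_inv hy]

/-- The Jacobian has the Jacobian of `φ.symm` as left inverse. -/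
theorem eq_zero_of_sum_pd_mul_eq_zero (hφ : IsCoordinates φ) {w : Vec N} (hw : w ∈ φ.source)
    {v : Vec N} (hv : ∀ i, ∑ a, pd a (fun w => φ w i) w * v a = 0) : v = 0 := by
  funext c
  have h : ∑ i, pd i (fun u => φ.symm u c) (φ w) * ∑ a, pd a (fun w => φ w i) w * v a = v c := by
    simp only [Finset.mul_sum]
    rw [Finset.sum_comm]
    simp only [← mul_assoc, ← Finset.sum_mul, hφ.sum_pd_symm_mul_pd hw]
    simp
  rw [← h]
  simp [hv]

theorem contDiff_comp (hφ : IsCoordinates φ) {w : ℝ → Vec N} (hw : ContDiff ℝ ∞ w)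
    (hws : ∀ x, w x ∈ φ.source) : ContDiff ℝ ∞ fun x => φ (w x) :=
  contDiff_pi.2 fun i => contDiff_comp_of_contDiffAt (fun x => hφ.contDiffAt_coe (hws x) i) hw

theorem deriv_comp (hφ : IsCoordinates φ) {w : ℝ → Vec N} (hw : ContDiff ℝ ∞ w)
    (hws : ∀ x, w x ∈ φ.source) (i : Fin N) (x : ℝ) :
    deriv (fun y => φ (w y) i) x
      = ∑ a, pd a (fun w => φ w i) (w x) * deriv (fun y => w y a) x :=
  deriv_comp_pd (f := fun w => φ w i) ((hφ.contDiffAt_coe (hws x) i).differentiableAt (by simp))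
    (hw.differentiable (by simp) x)

theorem sum_pd_symm_mul_deriv (hφ : IsCoordinates φ) {w : ℝ → Vec N} (hw : ContDiff ℝ ∞ w)
    (hws : ∀ x, w x ∈ φ.source) (c : Fin N) (x : ℝ) :
    ∑ k, pd k (fun u => φ.symm u c) (φ (w x)) * deriv (fun y => φ (w y) k) x
      = deriv (fun y => w y c) x := by
  simp only [hφ.deriv_comp hw hws, Finset.mul_sum]
  rw [Finset.sum_comm]
  simp only [← mul_assoc, ← Finset.sum_mul, hφ.sum_pd_symm_mul_pd (hws x)]
  simp

end IsCoordinates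

namespace Bracket

theorem inCoordinates_g_contDiffAt {B : Bracket N} {Ω : Set (Vec N)} (hB : B.SmoothOn Ω)
    (hΩ : IsOpen Ω) (hφ : IsCoordinates φ) (hφΩ : φ.source ⊆ Ω) {u : Vec N} (hu : u ∈ φ.target)
    (i j : Fin N) : ContDiffAt ℝ ∞ (fun u => (B.inCoordinates φ).g u i j) u := by
  have hs := hφ.contDiffAt_symm hu
  have hw := φ.map_target hu
  have hp : ∀ a i, ContDiffAt ℝ ∞ (fun u => pd a (fun w => φ w i) (φ.symm u)) u := fun a i =>
    ContDiffAt.comp (g := pd a fun w => φ w i) u (ContDiffAt.pd (hφ.contDiffAt_coe hw i) a) hs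
  simp only [inCoordinates]
  refine ContDiffAt.sum fun a _ => ContDiffAt.sum fun c _ => ((hp a i).mul ?_).mul (hp c j)
  exact ContDiffAt.comp (g := fun w => B.g w a c) u (hB.g_contDiffAt hΩ (hφΩ hw) a c) hs

theorem inCoordinates_b_contDiffAt {B : Bracket N} {Ω : Set (Vec N)} (hB : B.SmoothOn Ω)
    (hΩ : IsOpen Ω) (hφ : IsCoordinates φ) (hφΩ : φ.source ⊆ Ω) {u : Vec N} (hu : u ∈ φ.target)
    (i j k : Fin N) : ContDiffAt ℝ ∞ (fun u => (B.inCoordinates φ).b u i j k) u := by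
  have hs := hφ.contDiffAt_symm hu
  have hw := φ.map_target hu
  have hp : ∀ a i, ContDiffAt ℝ ∞ (fun u => pd a (fun w => φ w i) (φ.symm u)) u := fun a i =>
    ContDiffAt.comp (g := pd a fun w => φ w i) u (ContDiffAt.pd (hφ.contDiffAt_coe hw i) a) hs
  simp only [inCoordinates]
  refine ContDiffAt.sum fun a _ => ContDiffAt.sum fun e _ => ContDiffAt.sum fun c _ =>
    ((hp a i).mul (ContDiffAt.add (ContDiffAt.mul ?_ ?_) (ContDiffAt.mul ?_ (hp e j)))).mul
      (ContDiffAt.pd (contDiffAt_pi.1 hs c) k)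
  · exact ContDiffAt.comp (g := fun w => B.g w a e) u (hB.g_contDiffAt hΩ (hφΩ hw) a e) hs
  · exact ContDiffAt.comp (g := pd c (pd e fun w => φ w j)) u
      (ContDiffAt.pd (ContDiffAt.pd (hφ.contDiffAt_coe hw j) e) c) hs
  · exact ContDiffAt.comp (g := fun w => B.b w a e c) u (hB.b_contDiffAt hΩ (hφΩ hw) a e c) hs

/-- The operator of the bracket applied to the covector field with the only component `g` at
the place `j`. -/
noncomputable def scalarOp (C : Bracket N) (u : ℝ → Vec N) (g : ℝ → ℝ) (j : Fin N) (x : ℝ)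
    (i : Fin N) : ℝ :=
  C.g (u x) i j * deriv g x + (∑ k, C.b (u x) i j k * deriv (fun y => u y k) x) * g x
    + C.K * deriv (fun y => u y i) x * dinv (fun y => deriv (fun z => u z j) y * g y) x

/-- The covariance of the operator. Differentiating `g ∂uʲ/∂wᶜ` produces `g'` and second derivatives
of `φ`; the latter are the inhomogeneous part of the transformed `b`. -/
theorem sum_pd_mul_op (B : Bracket N) (hφ : IsCoordinates φ) {w : ℝ → Vec N}
    (hw : ContDiff ℝ ∞ w) (hws : ∀ x, w x ∈ φ.source) {g : ℝ → ℝ} (hg : ContDiff ℝ ∞ g)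
    (i j : Fin N) (x : ℝ) :
    ∑ a, pd a (fun w => φ w i) (w x) * B.op w (fun y c => g y * pd c (fun w => φ w j) (w y)) x a
      = (B.inCoordinates φ).scalarOp (fun y => φ (w y)) g j x i := by
  have hd : ∀ c, deriv (fun y => g y * pd c (fun w => φ w j) (w y)) x
      = deriv g x * pd c (fun w => φ w j) (w x)
        + g x * ∑ k, pd k (pd c fun w => φ w j) (w x) * deriv (fun y => w y k) x := by
    intro c
    have hp := (ContDiffAt.pd (hφ.contDiffAt_coe (hws x) j) c).differentiableAt (by simp)
    rw [← deriv_comp_pd hp (hw.differentiable (by simp) x)]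
    exact deriv_fun_mul (hg.differentiable (by simp) x)
      (hp.comp x (hw.differentiable (by simp) x))
  have hq : (fun y => ∑ c, deriv (fun z => w z c) y * (g y * pd c (fun w => φ w j) (w y)))
      = fun y => deriv (fun z => φ (w z) j) y * g y := by
    funext y
    rw [hφ.deriv_comp hw hws, Finset.sum_mul]
    exact Finset.sum_congr rfl fun c _ => by ring
  have hb : ∑ k, (B.inCoordinates φ).b (φ (w x)) i j k * deriv (fun y => φ (w y) k) x
      = ∑ a, ∑ e, ∑ c, pd a (fun w => φ w i) (w x)
        * (B.g (w x) a e * pd c (pd e fun w => φ w j) (w x)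
          + B.b (w x) a e c * pd e (fun w => φ w j) (w x)) * deriv (fun y => w y c) x := by
    simp only [← hφ.sum_pd_symm_mul_deriv hw hws, inCoordinates, φ.left_inv (hws x),
      Finset.sum_mul, Finset.mul_sum]
    rw [Finset.sum_comm]
    refine Finset.sum_congr rfl fun a _ => ?_
    rw [Finset.sum_comm]
    refine Finset.sum_congr rfl fun e _ => ?_
    rw [Finset.sum_comm]
    refine Finset.sum_congr rfl fun c _ => Finset.sum_congr rfl fun k _ => ?_
    ring
  rw [scalarOp, hb, hφ.deriv_comp hw hws i x]
  simp only [op, hq, hd]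
  simp only [inCoordinates, φ.left_inv (hws x)]
  simp only [mul_add, Finset.sum_add_distrib, Finset.mul_sum, Finset.sum_mul, add_mul]
  rw [← add_assoc]
  refine congrArg₂ _ (congrArg₂ _ (congrArg₂ _ ?_ ?_) ?_) ?_
  · exact Finset.sum_congr rfl fun a _ => Finset.sum_congr rfl fun c _ => by ring
  · exact Finset.sum_congr rfl fun a _ => Finset.sum_congr rfl fun c _ =>
      Finset.sum_congr rfl fun k _ => by ring
  · exact Finset.sum_congr rfl fun a _ => Finset.sum_congr rfl fun c _ =>
      Finset.sum_congr rfl fun k _ => by ring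
  · exact Finset.sum_congr rfl fun a _ => by ring

theorem scalarOp_of_flat {B : Bracket N} {η : Matrix (Fin N) (Fin N) ℝ}
    (hflat : IsFlatCoordinates B φ η) (hK : B.K = 0) {u : ℝ → Vec N}
    (hu : ∀ x, u x ∈ φ.target) (g : ℝ → ℝ) (j : Fin N) (x : ℝ) (i : Fin N) :
    (B.inCoordinates φ).scalarOp u g j x i = η i j * deriv g x := by
  obtain ⟨h1, h2⟩ := hflat.2 (u x) (hu x)
  have hK' : (B.inCoordinates φ).K = 0 := hK
  simp [scalarOp, h1, h2, hK']

/-- The `1`-form `(b^{ij}_k + K δ^i_k (u^j - c^j)) du^k`. -/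
noncomputable def form (C : Bracket N) (c : Vec N) (i j k : Fin N) (u : Vec N) : ℝ :=
  C.b u i j k + C.K * (if i = k then 1 else 0) * (u j - c j)

/-- On the plateau `g' = 0`, and `uʲ_x g = uʲ_x` everywhere because the field is constant off the
plateau. The nonlocal term thus becomes the local expression `K uⁱ_x (uʲ - cʲ)`. -/
theorem scalarOp_of_plateau (C : Bracket N) {u : ℝ → Vec N} (hu : ContDiff ℝ ∞ u) {c : Vec N}
    {R : ℝ} (hc : ∀ x, R ≤ |x| → u x = c) {g : ℝ → ℝ} (hg : ∀ x, |x| ≤ R → g x = 1)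
    (i j : Fin N) {x : ℝ} (hx : |x| < R) :
    C.scalarOp u g j x i = ∑ k, C.form c i j k (u x) * deriv (fun y => u y k) x := by
  have hgx : deriv g x = 0 := by
    have : g =ᶠ[nhds x] fun _ => 1 := by
      filter_upwards [(isOpen_lt continuous_abs continuous_const).mem_nhds hx] with y hy
      exact hg y (le_of_lt hy)
    rw [this.deriv_eq, deriv_const]
  have hq : (fun y => deriv (fun z => u z j) y * g y) = deriv fun z => u z j := by
    funext y
    rcases le_or_gt |y| R with hy | hy
    · rw [hg y hy, mul_one]
    · rw [deriv_eq_zero_of_const (f := fun z => u z j) (R := R) (c := c j)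
        (fun z hz => by rw [hc z hz]) hy, zero_mul]
  rw [scalarOp, hq, dinv_deriv (contDiff_pi.1 hu j) (fun z hz => by rw [hc z hz]), hgx,
    hg x hx.le]
  simp only [form, add_mul, Finset.sum_add_distrib, mul_assoc, ← Finset.mul_sum, ite_mul, one_mul,
    zero_mul, Finset.sum_ite_eq, Finset.mem_univ, if_true, mul_one, mul_zero, zero_add]
  ring

end Bracket

/-! ### Families of fields -/

theorem hasDerivAt_slice_fst {G : ℝ × ℝ → ℝ} {ε x : ℝ} (hG : DifferentiableAt ℝ G (ε, x)) :
    HasDerivAt (fun ε => G (ε, x)) (fderiv ℝ G (ε, x) (1, 0)) ε :=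
  hG.hasFDerivAt.comp_hasDerivAt (f := fun ε : ℝ => (ε, x)) ε
    ((hasDerivAt_id ε).prodMk (hasDerivAt_const ε x))

theorem hasDerivAt_slice_snd {G : ℝ × ℝ → ℝ} {ε x : ℝ} (hG : DifferentiableAt ℝ G (ε, x)) :
    HasDerivAt (fun x => G (ε, x)) (fderiv ℝ G (ε, x) (0, 1)) x :=
  hG.hasFDerivAt.comp_hasDerivAt (f := fun x : ℝ => (ε, x)) x
    ((hasDerivAt_const x ε).prodMk (hasDerivAt_id x))

theorem contDiffAt_deriv_snd {G : ℝ × ℝ → ℝ} {δ : ℝ}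
    (hG : ∀ ε x, |ε| < δ → ContDiffAt ℝ ∞ G (ε, x)) {ε x : ℝ} (hε : |ε| < δ) :
    ContDiffAt ℝ ∞ (fun p : ℝ × ℝ => deriv (fun y => G (p.1, y)) p.2) (ε, x) := by
  have h : ContDiffAt ℝ ∞ (fun p => fderiv ℝ G p (0, 1)) (ε, x) :=
    ((hG ε x hε).fderiv_right (m := ∞) (by simp)).clm_apply contDiffAt_const
  refine h.congr_of_eventuallyEq ?_
  have hn : {p : ℝ × ℝ | |p.1| < δ} ∈ nhds (ε, x) :=
    (isOpen_lt (by fun_prop) continuous_const).mem_nhds hε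
  filter_upwards [hn] with p hp
  exact (hasDerivAt_slice_snd ((hG p.1 p.2 hp).differentiableAt (by simp))).deriv

/-- Symmetry of the second derivative: the variation of `u_x` is the `x`-derivative of the variation
of `u`. -/
theorem hasDerivAt_deriv_comm {G : ℝ × ℝ → ℝ} {δ : ℝ} (hδ : 0 < δ)
    (hG : ∀ ε x, |ε| < δ → ContDiffAt ℝ ∞ G (ε, x)) (x : ℝ) :
    HasDerivAt (fun ε => deriv (fun y => G (ε, y)) x)
      (deriv (fun y => deriv (fun ε => G (ε, y)) 0) x) 0 := by
  have h0 : |(0 : ℝ)| < δ := by simpa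
  have hd : ∀ ε x, |ε| < δ → DifferentiableAt ℝ G (ε, x) := fun ε x hε =>
    (hG ε x hε).differentiableAt (by simp)
  have hF : DifferentiableAt ℝ (fderiv ℝ G) (0, x) :=
    ((hG 0 x h0).fderiv_right (m := ∞) (by simp)).differentiableAt (by simp)
  have hs : IsSymmSndFDerivAt ℝ G (0, x) := (hG 0 x h0).isSymmSndFDerivAt (by
    rw [minSmoothness_of_isRCLikeNormedField]; exact WithTop.coe_le_coe.2 (le_top (a := (2 : ℕ∞))))
  have e1 : deriv (fun y => deriv (fun ε => G (ε, y)) 0) x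
      = fderiv ℝ (fderiv ℝ G) (0, x) (1, 0) (0, 1) := by
    have : (fun y => deriv (fun ε => G (ε, y)) 0) = fun y => fderiv ℝ G (0, y) (1, 0) := by
      funext y; exact (hasDerivAt_slice_fst (hd 0 y h0)).deriv
    rw [this, (hasDerivAt_slice_snd (G := fun p => fderiv ℝ G p (1, 0))
      (hF.clm_apply (differentiableAt_const _))).deriv,
      fderiv_clm_apply hF (differentiableAt_const _), hs]
    simp
  rw [e1]
  have h2 := hasDerivAt_slice_fst (G := fun p => fderiv ℝ G p (0, 1)) (ε := 0) (x := x)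
    (hF.clm_apply (differentiableAt_const _))
  rw [fderiv_clm_apply hF (differentiableAt_const _)] at h2
  have h3 : HasDerivAt (fun ε => fderiv ℝ G (ε, x) (0, 1))
      (fderiv ℝ (fderiv ℝ G) (0, x) (1, 0) (0, 1)) 0 := by simpa using h2
  refine h3.congr_of_eventuallyEq ?_
  filter_upwards [(isOpen_lt continuous_abs continuous_const).mem_nhds h0] with ε hε
  exact (hasDerivAt_slice_snd (hd ε x hε)).deriv

/-- The first variation of `∫ f(x) θ_k(u) u^k_x dx`. -/
theorem hasDerivAt_integral_form (hφ : IsCoordinates φ) {w v : ℝ → Vec N}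
    (hw : IsField φ.source w) (hv : ContDiff ℝ ∞ v) (hvc : HasCompactSupport v)
    {θ : Fin N → Vec N → ℝ} (hθ : ∀ k, ∀ u ∈ φ.target, ContDiffAt ℝ ∞ (θ k) u)
    {f : ℝ → ℝ} (hf : ContDiff ℝ ∞ f) (hfc : HasCompactSupport f) {ν : ℝ → Vec N}
    (hν : ∀ x i, ∑ a, pd a (fun w => φ w i) (w x) * v x a = ν x i) :
    HasDerivAt
      (fun ε : ℝ => ∫ x, f x * ∑ k, θ k (φ ((w + ε • v) x)) * deriv (fun y => φ ((w + ε • v) y) k) x)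
      (∫ x, f x * ∑ k, ((∑ s, pd s (θ k) (φ (w x)) * ν x s) * deriv (fun y => φ (w y) k) x
        + θ k (φ (w x)) * deriv (fun y => ν y k) x)) 0 := by
  obtain ⟨δ, hδ, hfld⟩ := hw.exists_isField_add_smul φ.open_source hv hvc
  obtain ⟨R, hR, hfR⟩ := eq_zero_of_le_abs_of_hasCompactSupport hfc
  have hmem : ∀ ε x, |ε| < δ → w x + ε • v x ∈ φ.source := fun ε x hε => (hfld ε hε).2.1 x
  have h0 : |(0 : ℝ)| < δ := by simpa
  have hG : ∀ k ε x, |ε| < δ →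
      ContDiffAt ℝ ∞ (fun p : ℝ × ℝ => φ (w p.2 + p.1 • v p.2) k) (ε, x) := by
    intro k ε x hε
    have hw' := hw.1
    have h1 : ContDiff ℝ ∞ fun p : ℝ × ℝ => w p.2 + p.1 • v p.2 := by fun_prop
    exact ContDiffAt.comp (f := fun p : ℝ × ℝ => w p.2 + p.1 • v p.2)
      (g := fun u => φ u k) (ε, x) (hφ.contDiffAt_coe (hmem ε x hε) k) h1.contDiffAt
  have hH : ∀ ε x, |ε| < δ →
      ContDiffAt ℝ ∞ (fun p : ℝ × ℝ => φ (w p.2 + p.1 • v p.2)) (ε, x) := fun ε x hε =>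
    contDiffAt_pi.2 fun k => hG k ε x hε
  have key := hasDerivAt_integral_of_contDiffAt
    (Q := fun ε x => f x * ∑ k, θ k (φ (w x + ε • v x)) * deriv (fun y => φ (w y + ε • v y) k) x)
    (δ := δ) (R := R) hδ (fun ε x hε => ?_) (fun ε x _ hx => by rw [hfR x hx, zero_mul])
  · change HasDerivAt (fun ε : ℝ => ∫ x, f x * ∑ k, θ k (φ (w x + ε • v x))
      * deriv (fun y => φ (w y + ε • v y) k) x) _ 0
    convert key using 1
    refine integral_congr_ae (Filter.Eventually.of_forall fun x => ?_)
    have hνd : ∀ y k, HasDerivAt (fun ε : ℝ => φ (w y + ε • v y) k) (ν y k) 0 := by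
      intro y k
      have h1 : HasDerivAt (fun ε : ℝ => w y + ε • v y) (v y) 0 := by
        simpa using ((hasDerivAt_id (0 : ℝ)).smul_const (v y)).const_add (w y)
      have h2 := hasDerivAt_comp_pd (f := fun u => φ u k) (x := 0)
        ((hφ.contDiffAt_coe (hmem 0 y h0) k).differentiableAt (by simp)) h1
      simp only [zero_smul, add_zero, hν] at h2
      exact h2
    have hsum := HasDerivAt.fun_sum (u := Finset.univ) (x := (0 : ℝ))
      (A := fun (k : Fin N) (ε : ℝ) =>
        θ k (φ (w x + ε • v x)) * deriv (fun y => φ (w y + ε • v y) k) x)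
      (A' := fun k => (∑ s, pd s (θ k) (φ (w x)) * ν x s) * deriv (fun y => φ (w y) k) x
        + θ k (φ (w x)) * deriv (fun y => ν y k) x) fun k _ => by
        have ht : φ (w x + (0 : ℝ) • v x) ∈ φ.target := φ.map_source (hmem 0 x h0)
        have h1 := hasDerivAt_comp_pd (f := θ k) (γ := fun ε : ℝ => φ (w x + ε • v x)) (x := 0)
          ((hθ k _ ht).differentiableAt (by simp)) (hasDerivAt_pi.2 fun s => hνd x s)
        have h2 := hasDerivAt_deriv_comm hδ (hG k) x
        have e : (fun y => deriv (fun ε : ℝ => φ (w y + ε • v y) k) 0) = fun y => ν y k := by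
          funext y; exact (hνd y k).deriv
        simp only [e] at h2
        have h3 := h1.mul h2
        simp only [zero_smul, add_zero] at h3
        exact h3
    exact (hsum.const_mul (f x)).deriv.symm
  · refine ContDiffAt.mul (hf.contDiffAt.comp (ε, x) contDiffAt_snd) (ContDiffAt.sum fun k _ =>
      ContDiffAt.mul ?_ (contDiffAt_deriv_snd (hG k) hε))
    exact ContDiffAt.comp (g := θ k) (f := fun p : ℝ × ℝ => φ (w p.2 + p.1 • v p.2)) (ε, x)
      (hθ k _ (φ.map_source (hmem ε x hε))) (hH ε x hε)

/-! ### Functionals of the coordinates near a point -/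


/-- The functions `h¹, …, h^N` are smooth everywhere and are the coordinates `φ` on `W`. -/
structure IsExtension (φ : OpenPartialHomeomorph (Vec N) (Vec N)) (W : Set (Vec N))
    (h : Fin N → Vec N → ℝ) : Prop where
  isOpen : IsOpen W
  subset : W ⊆ φ.source
  contDiff : ∀ i, ContDiff ℝ ∞ (h i)
  eq : ∀ w ∈ W, ∀ i, h i w = φ w i

theorem IsCoordinates.exists_isExtension (hφ : IsCoordinates φ) {u₀ : Vec N}
    (hu₀ : u₀ ∈ φ.target) : ∃ W h, IsExtension φ W h ∧ φ.symm u₀ ∈ W := by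
  have hw := φ.map_target hu₀
  choose h hh he using fun i => exists_contDiff_eventuallyEq φ.open_source
    (fun w hw => hφ.contDiffAt_coe hw i) hw
  have hev : ∀ᶠ w in nhds (φ.symm u₀), w ∈ φ.source ∧ ∀ i, h i w = φ w i :=
    Filter.Eventually.and (φ.open_source.mem_nhds hw) (Filter.eventually_all.2 he)
  obtain ⟨W, hW, hWo, hW0⟩ := eventually_nhds_iff.1 hev
  exact ⟨W, h, ⟨hWo, fun w hw => (hW w hw).1, hh, fun w hw => (hW w hw).2⟩, hW0⟩

namespace IsExtension

variable {W : Set (Vec N)} {h : Fin N → Vec N → ℝ}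

theorem varDeriv_locFun (hW : IsExtension φ W h) {w : ℝ → Vec N} (hw : IsField W w) {f : ℝ → ℝ}
    (hf : ContDiff ℝ ∞ f) (hfc : HasCompactSupport f) (j : Fin N) :
    varDeriv (locFun f (h j)) w = fun x c => f x * pd c (fun w => φ w j) (w x) := by
  rw [(isVarDeriv_locFun hf hfc (hW.contDiff j) hw.1).varDeriv_eq]
  funext x c
  rw [pd_congr_of_eventuallyEq (f := h j) (g := fun w => φ w j)]
  filter_upwards [hW.isOpen.mem_nhds (hw.2.1 x)] with y hy
  exact hW.eq y hy j

theorem sum_pd_mul_op (hW : IsExtension φ W h) (hφ : IsCoordinates φ) (B : Bracket N)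
    {w : ℝ → Vec N} (hw : IsField W w) {g : ℝ → ℝ}
    (hg : ContDiff ℝ ∞ g) (hgc : HasCompactSupport g) (i j : Fin N) (x : ℝ) :
    ∑ a, pd a (fun w => φ w i) (w x) * B.op w (varDeriv (locFun g (h j)) w) x a
      = (B.inCoordinates φ).scalarOp (fun y => φ (w y)) g j x i := by
  rw [hW.varDeriv_locFun hw hg hgc,
    B.sum_pd_mul_op hφ hw.1 (fun x => hW.subset (hw.2.1 x)) hg]

theorem bracket_locFun (hW : IsExtension φ W h) (hφ : IsCoordinates φ) (B : Bracket N)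
    {w : ℝ → Vec N} (hw : IsField W w) {f g : ℝ → ℝ} (hf : ContDiff ℝ ∞ f)
    (hfc : HasCompactSupport f) (hg : ContDiff ℝ ∞ g) (hgc : HasCompactSupport g) (i j : Fin N) :
    B.bracket (locFun f (h i)) (locFun g (h j)) w
      = ∫ x, f x * (B.inCoordinates φ).scalarOp (fun y => φ (w y)) g j x i := by
  rw [Bracket.bracket]
  refine integral_congr_ae (Filter.Eventually.of_forall fun x => ?_)
  simp only [← hW.sum_pd_mul_op hφ B hw hg hgc, Finset.mul_sum]
  rw [hW.varDeriv_locFun hw hf hfc]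
  exact Finset.sum_congr rfl fun a _ => by ring

theorem bracket_locFun_of_flat (hW : IsExtension φ W h) {B : Bracket N}
    {η : Matrix (Fin N) (Fin N) ℝ} (hflat : IsFlatCoordinates B φ η) (hK : B.K = 0)
    {w : ℝ → Vec N} (hw : IsField W w) {f g : ℝ → ℝ} (hf : ContDiff ℝ ∞ f)
    (hfc : HasCompactSupport f) (hg : ContDiff ℝ ∞ g) (hgc : HasCompactSupport g) (i j : Fin N) :
    B.bracket (locFun f (h i)) (locFun g (h j)) w = ∫ x, f x * (η i j * deriv g x) := by
  rw [hW.bracket_locFun hflat.1 B hw hf hfc hg hgc]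
  simp only [Bracket.scalarOp_of_flat hflat hK
    (fun x => φ.map_source (hW.subset (hw.2.1 x)))]

theorem bracket_locFun_of_plateau (hW : IsExtension φ W h) (hφ : IsCoordinates φ) (B : Bracket N)
    {w : ℝ → Vec N} (hw : IsField W w) {c : Vec N} {R : ℝ} (hc : ∀ x, R ≤ |x| → φ (w x) = c)
    {f g : ℝ → ℝ} (hf : ContDiff ℝ ∞ f) (hfR : ∀ x, R ≤ |x| → f x = 0) (hg : ContDiff ℝ ∞ g)
    (hgc : HasCompactSupport g) (hgR : ∀ x, |x| ≤ R → g x = 1) (i j : Fin N) :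
    B.bracket (locFun f (h i)) (locFun g (h j)) w
      = ∫ x, f x * ∑ k, (B.inCoordinates φ).form c i j k (φ (w x))
          * deriv (fun y => φ (w y) k) x := by
  rw [hW.bracket_locFun hφ B hw hf (hasCompactSupport_of_eq_zero hfR) hg hgc]
  refine integral_congr_ae (Filter.Eventually.of_forall fun x => ?_)
  rcases lt_or_ge |x| R with hx | hx
  · simp only [Bracket.scalarOp_of_plateau _
      (hφ.contDiff_comp hw.1 fun x => hW.subset (hw.2.1 x)) hc hgR i j hx]
  · simp only [hfR x hx, zero_mul]

end IsExtension

/-! ### Fields through a given point -/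

/-- The function `x χ(x)` with `χ` a plateau around the origin. -/
theorem exists_contDiff_deriv_eq_one : ∃ f : ℝ → ℝ, ContDiff ℝ ∞ f ∧ HasCompactSupport f ∧
    (∀ x, 3 ≤ |x| → f x = 0) ∧ f 0 = 0 ∧ deriv f 0 = 1 := by
  obtain ⟨χ, hχ, -, h1, h2⟩ := exists_plateau 1
  have h3 : ∀ x, 3 ≤ |x| → x * χ x = 0 := fun x hx => by
    rw [h2 x (by norm_num; linarith), mul_zero]
  refine ⟨fun x => x * χ x, contDiff_id.mul hχ, hasCompactSupport_of_eq_zero h3, h3, by simp, ?_⟩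
  have : (fun x => x * χ x) =ᶠ[nhds 0] fun x => x := by
    filter_upwards [(isOpen_lt continuous_abs continuous_const).mem_nhds
      (show |(0 : ℝ)| < 1 by simp)] with y hy
    rw [h1 y (le_of_lt hy), mul_one]
  rw [this.deriv_eq]
  exact deriv_id 0

theorem exists_contDiff_deriv_deriv_ne_zero : ∃ l : ℝ → ℝ, ContDiff ℝ ∞ l ∧ HasCompactSupport l ∧
    ∃ x, deriv (deriv l) x ≠ 0 := by
  obtain ⟨l, hl, hlc, hl3, -, h1⟩ := exists_contDiff_deriv_eq_one
  refine ⟨l, hl, hlc, ?_⟩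
  by_contra! h
  have h4 := is_const_of_deriv_eq_zero ((contDiff_deriv hl).differentiable (by simp)) h 0 4
  rw [h1, deriv_eq_zero_of_const hl3 (by norm_num)] at h4
  exact one_ne_zero h4

/-- In coordinates the field is `u₀ + s f(x) e_k` with `f 0 = 0`, `f' 0 = 1`. Evaluating an identity
linear in `u_x` at `x = 0` isolates its `k`-th coefficient at `u₀`. -/
theorem IsCoordinates.exists_isField (hφ : IsCoordinates φ) {W : Set (Vec N)} (hW : IsOpen W)
    {u₀ : Vec N} (hu₀ : u₀ ∈ φ.target) (hW₀ : φ.symm u₀ ∈ W) (k : Fin N) :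
    ∃ (w : ℝ → Vec N) (s : ℝ), s ≠ 0 ∧ IsField W w ∧ (∀ x, 3 ≤ |x| → w x = φ.symm u₀) ∧
      φ (w 0) = u₀ ∧ ∀ l, deriv (fun y => φ (w y) l) 0 = if l = k then s else 0 := by
  obtain ⟨f, hf, hfc, hf3, hf0, hf1⟩ := exists_contDiff_deriv_eq_one
  have hn : φ.target ∩ φ.symm ⁻¹' W ∈ nhds u₀ :=
    Filter.inter_mem (φ.open_target.mem_nhds hu₀)
      ((φ.continuousAt_symm hu₀).preimage_mem_nhds (hW.mem_nhds hW₀))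
  obtain ⟨r, hr, hrW⟩ := Metric.mem_nhds_iff.1 hn
  obtain ⟨M, hM⟩ := hfc.exists_bound_of_continuous hf.continuous
  have hM0 : 0 ≤ M := (norm_nonneg _).trans (hM 0)
  -- As `|f| ≤ M`, this scale keeps the curve in the ball of radius `r`; the `+ 1` makes the
  -- inequality strict and the denominator positive.
  set s : ℝ := r / (M + 1) with hs
  have hs0 : 0 < s := by positivity
  let e : Vec N := Pi.single k 1
  have he : ‖e‖ ≤ 1 := by
    refine (pi_norm_le_iff_of_nonneg zero_le_one).2 fun l => ?_
    by_cases hl : l = k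
    · subst hl; simp [e]
    · simp [e, hl]
  have hmem : ∀ x, u₀ + (s * f x) • e ∈ φ.target ∩ φ.symm ⁻¹' W := by
    intro x
    refine hrW ?_
    rw [mem_ball_iff_norm, add_sub_cancel_left, norm_smul, norm_mul, Real.norm_of_nonneg hs0.le]
    calc s * ‖f x‖ * ‖e‖ ≤ s * M * 1 := by gcongr; exact hM x
      _ < s * (M + 1) := by nlinarith
      _ = r := by rw [hs]; field_simp
  have hu : ContDiff ℝ ∞ fun x => u₀ + (s * f x) • e := by fun_prop
  have hφw : ∀ x, φ (φ.symm (u₀ + (s * f x) • e)) = u₀ + (s * f x) • e := fun x =>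
    φ.right_inv (hmem x).1
  have h3 : ∀ x, 3 ≤ |x| → φ.symm (u₀ + (s * f x) • e) = φ.symm u₀ := fun x hx => by
    rw [hf3 x hx, mul_zero, zero_smul, add_zero]
  refine ⟨fun x => φ.symm (u₀ + (s * f x) • e), s, hs0.ne', IsField.of_const
    (contDiff_comp_of_contDiffAt (fun x => hφ.contDiffAt_symm (hmem x).1) hu)
    (fun x => (hmem x).2) h3, h3, ?_, fun l => ?_⟩
  · rw [hφw, hf0, mul_zero, zero_smul, add_zero]
  · simp only [hφw]
    have hd : HasDerivAt (fun y => (u₀ + (s * f y) • e) l) (s * 1 * e l) 0 := by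
      simp only [Pi.add_apply, Pi.smul_apply, smul_eq_mul]
      have h1 : HasDerivAt f 1 0 := hf1 ▸ (hf.differentiable (by simp) 0).hasDerivAt
      exact ((h1.const_mul s).mul_const (e l)).const_add (u₀ l)
    rw [hd.deriv]
    simp [e, Pi.single_apply]

theorem isField_const {W : Set (Vec N)} {w₀ : Vec N} (h : w₀ ∈ W) : IsField W fun _ => w₀ :=
  IsField.of_const contDiff_const (fun _ => h) (R := 0) fun _ _ => rfl

/-! ### Consequences of skew-symmetry -/

namespace Bracket

variable {B : Bracket N} {Ω : Set (Vec N)}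

/-- At a constant field only `∫ f g^{ij} g' dx` survives, and integration by parts compares it with
the transposed bracket. -/
theorem IsPoisson.inCoordinates_g_symm (hP : B.IsPoisson Ω) (hφ : IsCoordinates φ)
    (hφΩ : φ.source ⊆ Ω) {u : Vec N} (hu : u ∈ φ.target) (i j : Fin N) :
    (B.inCoordinates φ).g u i j = (B.inCoordinates φ).g u j i := by
  obtain ⟨W, h, hW, hW0⟩ := hφ.exists_isExtension hu
  have hw := isField_const hW0
  have hwΩ : IsField Ω fun _ : ℝ => φ.symm u := hw.mono (hW.subset.trans hφΩ)
  obtain ⟨g, hg, hgc, -, -, hg1⟩ := exists_contDiff_deriv_eq_one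
  have hX : (fun x => ((B.inCoordinates φ).g u i j - (B.inCoordinates φ).g u j i) * deriv g x)
      = 0 := by
    refine eq_zero_of_forall_integral_mul_eq_zero
      (continuous_const.mul (contDiff_deriv hg).continuous) fun f hf hfc => ?_
    have hskew := hP.2.1 (locFun f (h i)) (locFun g (h j))
      (isFunctional_locFun hf hfc (hW.contDiff i) Ω) (isFunctional_locFun hg hgc (hW.contDiff j) Ω)
      _ hwΩ
    rw [hW.bracket_locFun hφ B hw hf hfc hg hgc, hW.bracket_locFun hφ B hw hg hgc hf hfc] at hskew
    simp only [scalarOp, φ.right_inv hu, deriv_const, mul_zero, Finset.sum_const_zero, zero_mul,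
      add_zero] at hskew
    have e1 : ∀ x, f x * (((B.inCoordinates φ).g u i j - (B.inCoordinates φ).g u j i) * deriv g x)
        = f x * ((B.inCoordinates φ).g u i j * deriv g x)
          - (B.inCoordinates φ).g u j i * (f x * deriv g x) := fun x => by ring
    have e2 : ∀ x, g x * ((B.inCoordinates φ).g u j i * deriv f x)
        = (B.inCoordinates φ).g u j i * (g x * deriv f x) := fun x => by ring
    have hg1 := (contDiff_deriv hg).continuous
    simp only [e1]
    rw [integral_sub, hskew]
    · simp only [e2, integral_const_mul]
      rw [integral_mul_deriv_eq_neg hg hf (Or.inl hgc)]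
      simp only [mul_comm (deriv g _)]
      ring
    · exact (hf.continuous.mul (continuous_const.mul hg1)).integrable_of_hasCompactSupport
        hfc.mul_right
    · exact (continuous_const.mul (hf.continuous.mul hg1)).integrable_of_hasCompactSupport
        hfc.mul_right.mul_left
  have := congrFun hX 0
  simp only [hg1, mul_one, Pi.zero_apply] at this
  exact sub_eq_zero.1 this

/-- Skew-symmetry for `∫ f uⁱ` and a plateau functional of `uʲ`. The terms with `b` and the
integrated `g^{ji} f'` give the relation along the field, which is read off at `x = 0`. -/
theorem IsPoisson.pd_inCoordinates_g (hP : B.IsPoisson Ω) (hB : B.SmoothOn Ω) (hΩ : IsOpen Ω)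
    (hφ : IsCoordinates φ) (hφΩ : φ.source ⊆ Ω) {u : Vec N} (hu : u ∈ φ.target) (i j k : Fin N) :
    pd k (fun u => (B.inCoordinates φ).g u j i) u
      = (B.inCoordinates φ).b u i j k + (B.inCoordinates φ).b u j i k := by
  obtain ⟨W, h, hW, hW0⟩ := hφ.exists_isExtension hu
  obtain ⟨w, s, hs, hw, hc, hw0, hd⟩ := hφ.exists_isField hW.isOpen hu hW0 k
  have hwΩ : IsField Ω w := hw.mono (hW.subset.trans hφΩ)
  have hws : ∀ x, w x ∈ φ.source := fun x => hW.subset (hw.2.1 x)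
  have hwt : ∀ x, φ (w x) ∈ φ.target := fun x => φ.map_source (hws x)
  set C := B.inCoordinates φ with hC
  have hU := hφ.contDiff_comp hw.1 hws
  have hUk := contDiff_pi.1 hU
  have hU1 : ∀ k, Continuous (deriv fun y => φ (w y) k) := fun k => (contDiff_deriv (hUk k)).continuous
  have hUc : ∀ x, 3 ≤ |x| → φ (w x) = u := fun x hx => by rw [hc x hx, φ.right_inv hu]
  have hbc : ∀ i j k, Continuous fun x => C.b (φ (w x)) i j k := fun i j k =>
    (contDiff_comp_of_contDiffAt (f := fun u => C.b u i j k)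
      (fun x => inCoordinates_b_contDiffAt hB hΩ hφ hφΩ (hwt x) i j k) hU).continuous
  have hgs : ContDiff ℝ ∞ fun x => C.g (φ (w x)) j i :=
    contDiff_comp_of_contDiffAt (f := fun u => C.g u j i)
      (fun x => inCoordinates_g_contDiffAt hB hΩ hφ hφΩ (hwt x) j i) hU
  have hX : (fun x => (∑ k, (C.b (φ (w x)) i j k + C.b (φ (w x)) j i k)
      * deriv (fun y => φ (w y) k) x) - deriv (fun y => C.g (φ (w y)) j i) x) = 0 := by
    refine eq_zero_of_forall_integral_mul_eq_zero ((continuous_finsetSum _ fun k _ =>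
      ((hbc i j k).add (hbc j i k)).mul (hU1 k)).sub (contDiff_deriv hgs).continuous)
      fun f hf hfc => ?_
    obtain ⟨R', hR', hfR'⟩ := eq_zero_of_le_abs_of_hasCompactSupport hfc
    set R := max R' 3 + 1 with hR
    have hfR : ∀ x, R ≤ |x| → f x = 0 := fun x hx =>
      hfR' x (by linarith [le_max_left R' 3])
    have hdfR : ∀ x, R ≤ |x| → deriv f x = 0 := fun x hx =>
      deriv_eq_zero_of_const hfR' (by linarith [le_max_left R' 3])
    have hUR : ∀ x, R ≤ |x| → φ (w x) = u := fun x hx => hUc x (by linarith [le_max_right R' 3])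
    have hdU : ∀ l x, R ≤ |x| → deriv (fun y => φ (w y) l) x = 0 := fun l x hx =>
      deriv_eq_zero_of_const (R := 3) (c := u l) (fun y hy => by rw [hUc y hy])
        (by linarith [le_max_right R' 3])
    obtain ⟨g, hg, hgc, hg1, -⟩ := exists_plateau R
    have hskew := hP.2.1 (locFun f (h i)) (locFun g (h j))
      (isFunctional_locFun hf hfc (hW.contDiff i) Ω) (isFunctional_locFun hg hgc (hW.contDiff j) Ω)
      _ hwΩ
    rw [hW.bracket_locFun_of_plateau hφ B hw hUR hf hfR hg hgc hg1,
      hW.bracket_locFun hφ B hw hg hgc hf hfc] at hskew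
    have hq : Continuous fun y => deriv (fun z => φ (w z) i) y * f y :=
      (hU1 i).mul hf.continuous
    have hqc : HasCompactSupport fun y => deriv (fun z => φ (w z) i) y * f y := hfc.mul_left
    have e1 : ∀ x, g x * C.scalarOp (fun y => φ (w y)) f i x j
        = C.g (φ (w x)) j i * deriv f x
          + f x * (∑ k, C.b (φ (w x)) j i k * deriv (fun y => φ (w y) k) x)
          + C.K * (deriv (fun y => φ (w y) j) x
            * dinv (fun y => deriv (fun z => φ (w z) i) y * f y) x) := by
      intro x
      rcases le_or_gt R |x| with hx | hx
      · simp [scalarOp, hfR x hx, hdfR x hx, hdU _ x hx]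
      · rw [hg1 x hx.le, scalarOp]; ring
    have e2 : ∀ x, f x * ∑ k, C.form u i j k (φ (w x)) * deriv (fun y => φ (w y) k) x
        = f x * (∑ k, C.b (φ (w x)) i j k * deriv (fun y => φ (w y) k) x)
          + C.K * ((φ (w x) j - u j) * (deriv (fun y => φ (w y) i) x * f x)) := by
      intro x
      simp only [form, add_mul, Finset.sum_add_distrib, mul_assoc, ← Finset.mul_sum, ite_mul,
        one_mul, zero_mul, Finset.sum_ite_eq, Finset.mem_univ, if_true]
      ring
    have e3 : ∀ x, f x * ((∑ k, (C.b (φ (w x)) i j k + C.b (φ (w x)) j i k)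
        * deriv (fun y => φ (w y) k) x) - deriv (fun y => C.g (φ (w y)) j i) x)
        = f x * (∑ k, C.b (φ (w x)) i j k * deriv (fun y => φ (w y) k) x)
          + f x * (∑ k, C.b (φ (w x)) j i k * deriv (fun y => φ (w y) k) x)
          - deriv (fun y => C.g (φ (w y)) j i) x * f x := by
      intro x
      simp only [add_mul, Finset.sum_add_distrib]
      ring
    have hbi : ∀ i j, Integrable fun x =>
        f x * (∑ k, C.b (φ (w x)) i j k * deriv (fun y => φ (w y) k) x) := fun i j =>
      (hf.continuous.mul (continuous_finsetSum _ fun k _ =>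
        (hbc i j k).mul (hU1 k))).integrable_of_hasCompactSupport hfc.mul_right
    have hUcs : HasCompactSupport (deriv fun y => φ (w y) j) :=
      hasCompactSupport_of_eq_zero (hdU j)
    have hi1 : Integrable fun x => C.g (φ (w x)) j i * deriv f x :=
      (hgs.continuous.mul (contDiff_deriv hf).continuous).integrable_of_hasCompactSupport
        hfc.deriv.mul_left
    have hi2 : Integrable fun x => C.K * (deriv (fun y => φ (w y) j) x
        * dinv (fun y => deriv (fun z => φ (w z) i) y * f y) x) :=
      (((hU1 j).mul (continuous_dinv hq hqc)).integrable_of_hasCompactSupport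
        hUcs.mul_right).const_mul _
    have hi3 : Integrable fun x => C.K * ((φ (w x) j - u j)
        * (deriv (fun y => φ (w y) i) x * f x)) :=
      ((((hUk j).continuous.sub continuous_const).mul hq).integrable_of_hasCompactSupport
        hqc.mul_left).const_mul _
    have hi4 : Integrable fun x => deriv (fun y => C.g (φ (w y)) j i) x * f x :=
      ((contDiff_deriv hgs).continuous.mul hf.continuous).integrable_of_hasCompactSupport
        hfc.mul_left
    have hi5 : Integrable fun x => C.g (φ (w x)) j i * deriv f x
        + f x * (∑ k, C.b (φ (w x)) j i k * deriv (fun y => φ (w y) k) x) := hi1.add (hbi j i)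
    have hi6 : Integrable fun x => f x * (∑ k, C.b (φ (w x)) i j k * deriv (fun y => φ (w y) k) x)
        + f x * (∑ k, C.b (φ (w x)) j i k * deriv (fun y => φ (w y) k) x) :=
      (hbi i j).add (hbi j i)
    simp only [← hC, e1, e2] at hskew
    -- Integrating `uʲ_x dinv(uⁱ_x f)` by parts gives the opposite of the nonlocal part of `form`,
    -- so all terms with `K` cancel.
    rw [integral_add (hbi i j) hi3, integral_add hi5 hi2,
      integral_add hi1 (hbi j i), integral_const_mul, integral_const_mul,
      integral_deriv_mul_dinv (hUk j) (c := u j) (fun x hx => by rw [hUR x hx]) hq hqc,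
      integral_mul_deriv_eq_neg hgs hf (Or.inr hfc)] at hskew
    simp only [e3]
    rw [integral_sub hi6 hi4, integral_add (hbi i j) (hbi j i)]
    linarith
  have h0 := congrFun hX 0
  have hgd := deriv_comp_pd (f := fun u => C.g u j i) (γ := fun x => φ (w x)) (x := 0)
    ((inCoordinates_g_contDiffAt hB hΩ hφ hφΩ (hwt 0) j i).differentiableAt (by simp))
    (hU.differentiable (by simp) 0)
  simp only [hgd, hd, hw0, mul_ite, mul_zero, Finset.sum_ite_eq', Finset.mem_univ, if_true,
    Pi.zero_apply] at h0
  rw [← sub_mul] at h0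
  linarith [(mul_eq_zero.1 h0).resolve_right hs]

end Bracket

/-! ### Consequences of compatibility -/


namespace Bracket

theorem form_contDiffAt {B : Bracket N} {Ω : Set (Vec N)} (hB : B.SmoothOn Ω)
    (hΩ : IsOpen Ω) (hφ : IsCoordinates φ) (hφΩ : φ.source ⊆ Ω) {u : Vec N} (hu : u ∈ φ.target)
    (c : Vec N) (i j k : Fin N) :
    ContDiffAt ℝ ∞ ((B.inCoordinates φ).form c i j k) u := by
  have h1 := inCoordinates_b_contDiffAt hB hΩ hφ hφΩ hu i j k
  have h2 : ContDiffAt ℝ ∞ (fun u : Vec N => u j - c j) u := by fun_prop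
  exact h1.add (contDiffAt_const.mul h2)

end Bracket

namespace IsExtension

variable {W : Set (Vec N)} {h : Fin N → Vec N → ℝ}

/-- Since `v` vanishes beyond `R`, the perturbed fields keep the same value at infinity and the same
plateau. The bracket therefore stays the integral of one fixed form for small `ε`. -/
theorem hasDerivAt_bracket_of_plateau (hW : IsExtension φ W h) (hφ : IsCoordinates φ)
    {B : Bracket N} {Ω : Set (Vec N)} (hB : B.SmoothOn Ω) (hΩ : IsOpen Ω) (hφΩ : φ.source ⊆ Ω)
    {w : ℝ → Vec N} (hw : IsField W w) {w₀ : Vec N} {R : ℝ} (hc : ∀ x, R ≤ |x| → w x = w₀)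
    {f g : ℝ → ℝ} (hf : ContDiff ℝ ∞ f) (hfR : ∀ x, R ≤ |x| → f x = 0) (hg : ContDiff ℝ ∞ g)
    (hgc : HasCompactSupport g) (hgR : ∀ x, |x| ≤ R → g x = 1) (i j : Fin N)
    {v ν : ℝ → Vec N} (hv : ContDiff ℝ ∞ v) (hvR : ∀ x, R ≤ |x| → v x = 0)
    (hν : ∀ x i, ∑ a, pd a (fun w => φ w i) (w x) * v x a = ν x i) :
    HasDerivAt (fun ε : ℝ => B.bracket (locFun f (h i)) (locFun g (h j)) (w + ε • v))
      (∫ x, f x * ∑ k, ((∑ s, pd s ((B.inCoordinates φ).form (φ w₀) i j k) (φ (w x)) * ν x s)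
          * deriv (fun y => φ (w y) k) x
        + (B.inCoordinates φ).form (φ w₀) i j k (φ (w x)) * deriv (fun y => ν y k) x)) 0 := by
  have hvc := hasCompactSupport_of_eq_zero hvR
  obtain ⟨δ, hδ, hfld⟩ := hw.exists_isField_add_smul hW.isOpen hv hvc
  refine (hasDerivAt_integral_form hφ (hw.mono hW.subset) hv hvc
    (fun k u hu => Bracket.form_contDiffAt hB hΩ hφ hφΩ hu (φ w₀) i j k) hf
    (hasCompactSupport_of_eq_zero hfR) hν).congr_of_eventuallyEq ?_
  filter_upwards [(isOpen_lt continuous_abs continuous_const).mem_nhds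
    (show |(0 : ℝ)| < δ by simpa)] with ε hε
  refine hW.bracket_locFun_of_plateau hφ B (hfld ε hε) (c := φ w₀) (fun x hx => ?_) hf hfR hg hgc
    hgR i j
  simp [hc x hx, hvR x hx]

/-- The variation lives where `f` and `g` vanish. The nonlocal term also notices nothing, because
`dinv` is applied to `uʲ_x g` and the result is multiplied by `f`. -/
theorem eventually_bracket_eq_of_disjoint (hW : IsExtension φ W h) (hφ : IsCoordinates φ)
    (B : Bracket N) {w : ℝ → Vec N} (hw : IsField W w) {R : ℝ}
    {f g : ℝ → ℝ} (hf : ContDiff ℝ ∞ f) (hfR : ∀ x, R ≤ |x| → f x = 0) (hg : ContDiff ℝ ∞ g)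
    (hgR : ∀ x, R ≤ |x| → g x = 0) (i j : Fin N)
    {v : ℝ → Vec N} (hv : ContDiff ℝ ∞ v) (hvc : HasCompactSupport v)
    (hvR : ∀ x, |x| < R → v x = 0) :
    ∀ᶠ ε : ℝ in nhds 0, B.bracket (locFun f (h i)) (locFun g (h j)) (w + ε • v)
      = B.bracket (locFun f (h i)) (locFun g (h j)) w := by
  obtain ⟨δ, hδ, hfld⟩ := hw.exists_isField_add_smul hW.isOpen hv hvc
  have hfc := hasCompactSupport_of_eq_zero hfR
  have hgc := hasCompactSupport_of_eq_zero hgR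
  filter_upwards [(isOpen_lt continuous_abs continuous_const).mem_nhds
    (show |(0 : ℝ)| < δ by simpa)] with ε hε
  have he : ∀ x, |x| < R → (w + ε • v) x = w x := fun x hx => by simp [hvR x hx]
  have hd : ∀ k x, |x| < R → deriv (fun y => φ ((w + ε • v) y) k) x
      = deriv (fun y => φ (w y) k) x := by
    intro k x hx
    refine Filter.EventuallyEq.deriv_eq ?_
    filter_upwards [(isOpen_lt continuous_abs continuous_const).mem_nhds hx] with y hy
    rw [he y hy]
  have hq : (fun y => deriv (fun z => φ ((w + ε • v) z) j) y * g y)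
      = fun y => deriv (fun z => φ (w z) j) y * g y := by
    funext y
    rcases lt_or_ge |y| R with hy | hy
    · rw [hd j y hy]
    · rw [hgR y hy, mul_zero, mul_zero]
  rw [hW.bracket_locFun hφ B (hfld ε hε) hf hfc hg hgc, hW.bracket_locFun hφ B hw hf hfc hg hgc]
  refine integral_congr_ae (Filter.Eventually.of_forall fun x => ?_)
  rcases lt_or_ge |x| R with hx | hx
  · simp only [Bracket.scalarOp, hq, he x hx, hd _ x hx]
  · simp only [hfR x hx, zero_mul]

/-- The mixed Jacobi identity for the functionals of `f uⁱ`, `u^j` and `l u^m`. -/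
theorem integral_form_eq (hW : IsExtension φ W h) {B₁ B₂ : Bracket N} {Ω : Set (Vec N)}
    (h₁ : B₁.SmoothOn Ω) (h₂ : B₂.SmoothOn Ω) (hΩ : IsOpen Ω) (hφΩ : φ.source ⊆ Ω)
    (hK : B₂.K = 0) (hcomp : Bracket.Compatible Ω B₁ B₂) {η : Matrix (Fin N) (Fin N) ℝ}
    (hflat : IsFlatCoordinates B₂ φ η)
    {w : ℝ → Vec N} (hw : IsField W w) {w₀ : Vec N} {R : ℝ} (hc : ∀ x, R ≤ |x| → w x = w₀)
    {f l : ℝ → ℝ} (hf : ContDiff ℝ ∞ f) (hfR : ∀ x, R ≤ |x| → f x = 0) (hl : ContDiff ℝ ∞ l)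
    (hlR : ∀ x, R ≤ |x| → l x = 0) (i j m : Fin N) :
    ∫ x, f x * ∑ k, ((∑ s, pd s ((B₁.inCoordinates φ).form (φ w₀) i j k) (φ (w x))
          * (η s m * deriv l x)) * deriv (fun y => φ (w y) k) x
        + (B₁.inCoordinates φ).form (φ w₀) i j k (φ (w x))
          * deriv (fun y => η k m * deriv l y) x)
    = ∫ x, l x * ∑ k, ((∑ s, pd s ((B₁.inCoordinates φ).form (φ w₀) m j k) (φ (w x))
          * (η s i * deriv f x)) * deriv (fun y => φ (w y) k) x
        + (B₁.inCoordinates φ).form (φ w₀) m j k (φ (w x))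
          * deriv (fun y => η k i * deriv f y) x) := by
  have hφ := hflat.1
  have hwΩ : IsField Ω w := hw.mono (hW.subset.trans hφΩ)
  have hws : ∀ x, w x ∈ φ.source := fun x => hW.subset (hw.2.1 x)
  have hP : B₁.IsPoisson Ω := by simpa [Bracket.lin_one_zero] using hcomp 1 0
  -- The margin 1 makes the derivatives of `f` and `l` vanish on the closed region `|x| ≥ R + 1`,
  -- boundary included.
  obtain ⟨g, hg, hgc, hg1, -⟩ := exists_plateau (R + 1)
  have hfR' : ∀ x, R + 1 ≤ |x| → f x = 0 := fun x hx => hfR x (by linarith)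
  have hlR' : ∀ x, R + 1 ≤ |x| → l x = 0 := fun x hx => hlR x (by linarith)
  have hc' : ∀ x, R + 1 ≤ |x| → w x = w₀ := fun x hx => hc x (by linarith)
  have hfc := hasCompactSupport_of_eq_zero hfR
  have hlc := hasCompactSupport_of_eq_zero hlR
  let F : Fin 3 → ℝ → ℝ := ![f, g, l]
  let ι : Fin 3 → Fin N := ![i, j, m]
  have hF : ∀ p, ContDiff ℝ ∞ (F p) := by
    intro p; fin_cases p <;> assumption
  have hFc : ∀ p, HasCompactSupport (F p) := by
    intro p; fin_cases p <;> assumption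
  let I : Fin 3 → (ℝ → Vec N) → ℝ := fun p => locFun (F p) (h (ι p))
  have hI : ∀ p, IsFunctional Ω (I p) := fun p =>
    isFunctional_locFun (hF p) (hFc p) (hW.contDiff _) Ω
  have hconst : ∀ p q v, ContDiff ℝ ∞ v → HasCompactSupport v →
      ∀ᶠ ε : ℝ in nhds 0, B₂.bracket (I p) (I q) (w + ε • v) = B₂.bracket (I p) (I q) w := by
    intro p q v hv hvc
    obtain ⟨δ, hδ, hfld⟩ := hw.exists_isField_add_smul hW.isOpen hv hvc
    filter_upwards [(isOpen_lt continuous_abs continuous_const).mem_nhds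
      (show |(0 : ℝ)| < δ by simpa)] with ε hε
    rw [hW.bracket_locFun_of_flat hflat hK (hfld ε hε) (hF p) (hFc p) (hF q) (hFc q),
      hW.bracket_locFun_of_flat hflat hK hw (hF p) (hFc p) (hF q) (hFc q)]
  obtain ⟨d, hd0, hd⟩ := hcomp.mixed_jacobi h₁ h₂ hΩ hK hwΩ hI hconst
  set V : Fin 3 → ℝ → Vec N := fun p => B₂.op w (varDeriv (I p) w) with hV
  have hVs : ∀ p, ContDiff ℝ ∞ (V p) := fun p =>
    Bracket.contDiff_op_of_local h₂ hΩ hK hwΩ ((hI p).isVarDeriv_varDeriv hwΩ).1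
  have hVc : ∀ p, HasCompactSupport (V p) := fun p => by
    obtain ⟨R', d, hd⟩ := (hI p).exists_const hwΩ
    exact Bracket.hasCompactSupport_op hwΩ hd
  have hVν : ∀ p x k, ∑ a, pd a (fun w => φ w k) (w x) * V p x a
      = η k (ι p) * deriv (F p) x := fun p x k => by
    rw [hV, hW.sum_pd_mul_op hφ B₂ hw (hF p) (hFc p),
      Bracket.scalarOp_of_flat hflat hK fun x => φ.map_source (hws x)]
  have hV0 : ∀ p x, deriv (F p) x = 0 → V p x = 0 := fun p x hx =>
    hφ.eq_zero_of_sum_pd_mul_eq_zero (hws x) fun k => by rw [hVν, hx, mul_zero]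
  have hV0R : ∀ x, R + 1 ≤ |x| → V 0 x = 0 := fun x hx =>
    hV0 0 x (deriv_eq_zero_of_const (f := f) hfR (by linarith))
  have hV2R : ∀ x, R + 1 ≤ |x| → V 2 x = 0 := fun x hx =>
    hV0 2 x (deriv_eq_zero_of_const (f := l) hlR (by linarith))
  have hV1R : ∀ x, |x| < R + 1 → V 1 x = 0 := fun x hx => by
    refine hV0 1 x ?_
    have : g =ᶠ[nhds x] fun _ => 1 := by
      filter_upwards [(isOpen_lt continuous_abs continuous_const).mem_nhds hx] with y hy
      exact hg1 y (le_of_lt hy)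
    change deriv g x = 0
    rw [this.deriv_eq, deriv_const]
  have t1 := hW.hasDerivAt_bracket_of_plateau hφ h₁ hΩ hφΩ hw hc' hf hfR' hg hgc hg1 i j (hVs 2)
    hV2R (hVν 2)
  have t2 := hW.hasDerivAt_bracket_of_plateau hφ h₁ hΩ hφΩ hw hc' hl hlR' hg hgc hg1 m j (hVs 0)
    hV0R (hVν 0)
  -- The form expression needs the plateau functional in second place.
  have hskew : (fun ε : ℝ => B₁.bracket (I 1) (I 2) (w + ε • V 0))
      =ᶠ[nhds 0] fun ε : ℝ => -B₁.bracket (I 2) (I 1) (w + ε • V 0) := by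
    obtain ⟨δ, hδ, hfld⟩ := hwΩ.exists_isField_add_smul hΩ (hVs 0) (hVc 0)
    filter_upwards [(isOpen_lt continuous_abs continuous_const).mem_nhds
      (show |(0 : ℝ)| < δ by simpa)] with ε hε
    exact hP.2.1 _ _ (hI 1) (hI 2) _ (hfld ε hε)
  have t2' := HasDerivAt.congr_of_eventuallyEq t2.neg hskew
  -- The flow of the plateau functional is proportional to `g'`, hence supported off the plateau.
  have t3 : HasDerivAt (fun ε : ℝ => B₁.bracket (I 2) (I 0) (w + ε • V 1)) 0 0 :=
    (hasDerivAt_const (0 : ℝ) (B₁.bracket (I 2) (I 0) w)).congr_of_eventuallyEq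
      (hW.eventually_bracket_eq_of_disjoint hφ B₁ hw hl hlR' hf hfR' m i (hVs 1) (hVc 1) hV1R)
  rw [(hd 0 1 2).unique t1, (hd 1 2 0).unique t2', (hd 2 0 1).unique t3] at hd0
  rw [add_zero, ← sub_eq_add_neg] at hd0
  exact sub_eq_zero.1 hd0

end IsExtension

/-- Integration by parts in the first variation of `∫ θ_k(u) u^k_x dx`. -/
theorem integral_variation_eq {θ : Fin N → Vec N → ℝ} {u : ℝ → Vec N} (hU : ContDiff ℝ ∞ u)
    (hθ : ∀ k x, ContDiffAt ℝ ∞ (θ k) (u x)) (e : Fin N → ℝ) {l : ℝ → ℝ} (hl : ContDiff ℝ ∞ l)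
    (hlc : HasCompactSupport l) :
    ∫ x, ∑ k, (deriv l x * ((∑ s, pd s (θ k) (u x) * e s) * deriv (fun y => u y k) x)
        + e k * (θ k (u x) * deriv (deriv l) x))
      = ∫ x, deriv l x * ∑ k, (∑ s, (pd s (θ k) (u x) - pd k (θ s) (u x)) * e s)
          * deriv (fun y => u y k) x := by
  have hl1 := contDiff_deriv hl
  have hl2 := contDiff_deriv hl1
  have hU1 : ∀ k, ContDiff ℝ ∞ (deriv fun y => u y k) := fun k =>
    contDiff_deriv (contDiff_pi.1 hU k)
  have hθs : ∀ k, ContDiff ℝ ∞ fun x => θ k (u x) := fun k =>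
    contDiff_comp_of_contDiffAt (hθ k) hU
  have hpθ : ∀ s k, ContDiff ℝ ∞ fun x => pd s (θ k) (u x) := fun s k =>
    contDiff_comp_of_contDiffAt (fun x => ContDiffAt.pd (hθ k x) s) hU
  have hlc1 : HasCompactSupport (deriv l) := hlc.deriv
  have i1 : ∀ k, Integrable fun x =>
      deriv l x * ((∑ s, pd s (θ k) (u x) * e s) * deriv (fun y => u y k) x) :=
    fun k => (hl1.continuous.mul ((continuous_finsetSum _ fun s _ =>
      (hpθ s k).continuous.mul continuous_const).mul
        (hU1 k).continuous)).integrable_of_hasCompactSupport hlc1.mul_right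
  have i2 : ∀ k, Integrable fun x => e k * (θ k (u x) * deriv (deriv l) x) := fun k =>
    (((hθs k).continuous.mul hl2.continuous).integrable_of_hasCompactSupport
      hlc1.deriv.mul_left).const_mul _
  have i3 : ∀ k, Integrable fun x => e k * (deriv (fun y => θ k (u y)) x * deriv l x) := fun k =>
    (((contDiff_deriv (hθs k)).continuous.mul hl1.continuous).integrable_of_hasCompactSupport
      hlc1.mul_left).const_mul _
  have i12 : ∀ k, Integrable fun x =>
      deriv l x * ((∑ s, pd s (θ k) (u x) * e s) * deriv (fun y => u y k) x)
        + e k * (θ k (u x) * deriv (deriv l) x) := fun k => (i1 k).add (i2 k)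
  have i13 : ∀ k, Integrable fun x =>
      deriv l x * ((∑ s, pd s (θ k) (u x) * e s) * deriv (fun y => u y k) x)
        - e k * (deriv (fun y => θ k (u y)) x * deriv l x) := fun k => (i1 k).sub (i3 k)
  rw [integral_finsetSum _ fun k _ => i12 k]
  -- Moving one derivative from `l''` onto `θ_k(u)` produces the second half of the antisymmetrized
  -- derivative of `θ`.
  have e3 : ∀ k, ∫ x, (deriv l x * ((∑ s, pd s (θ k) (u x) * e s) * deriv (fun y => u y k) x)
        + e k * (θ k (u x) * deriv (deriv l) x))
      = ∫ x, (deriv l x * ((∑ s, pd s (θ k) (u x) * e s) * deriv (fun y => u y k) x)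
        - e k * (deriv (fun y => θ k (u y)) x * deriv l x)) := by
    intro k
    rw [integral_add (i1 k) (i2 k), integral_sub (i1 k) (i3 k), integral_const_mul,
      integral_const_mul, integral_mul_deriv_eq_neg (hθs k) hl1 (Or.inr hlc1)]
    ring
  simp only [e3]
  rw [← integral_finsetSum _ fun k _ => i13 k]
  refine integral_congr_ae (Filter.Eventually.of_forall fun x => ?_)
  have e4 : ∀ k, deriv (fun y => θ k (u y)) x
      = ∑ s, pd s (θ k) (u x) * deriv (fun y => u y s) x := fun k =>
    deriv_comp_pd ((hθ k x).differentiableAt (by simp)) (hU.differentiable (by simp) x)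
  have e5 : ∑ k, (∑ s, pd k (θ s) (u x) * e s) * deriv (fun y => u y k) x
      = ∑ k, e k * ∑ s, pd s (θ k) (u x) * deriv (fun y => u y s) x := by
    simp only [Finset.sum_mul, Finset.mul_sum]
    rw [Finset.sum_comm]
    exact Finset.sum_congr rfl fun k _ => Finset.sum_congr rfl fun s _ => by ring
  simp only [e4, sub_mul, Finset.sum_sub_distrib]
  rw [e5, mul_sub, Finset.mul_sum, Finset.mul_sum]
  congr 1
  exact Finset.sum_congr rfl fun k _ => by ring

/-! ### Symmetry and closedness from the mixed Jacobi identity -/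

namespace Bracket

variable {B₁ B₂ : Bracket N} {Ω : Set (Vec N)} {η : Matrix (Fin N) (Fin N) ℝ}

/-- A constant field kills all `u_x` terms and the nonlocal part of the form. What remains is a
multiple of `∫ f l''` on one side and of `∫ l f'' = ∫ f l''` on the other. -/
theorem Compatible.sum_b_mul_eq (hcomp : Compatible Ω B₁ B₂) (h₁ : B₁.SmoothOn Ω)
    (h₂ : B₂.SmoothOn Ω) (hΩ : IsOpen Ω) (hφΩ : φ.source ⊆ Ω) (hK : B₂.K = 0)
    (hflat : IsFlatCoordinates B₂ φ η) {u : Vec N} (hu : u ∈ φ.target) (i j m : Fin N) :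
    ∑ k, (B₁.inCoordinates φ).b u i j k * η k m = ∑ k, (B₁.inCoordinates φ).b u m j k * η k i := by
  obtain ⟨W, h, hW, hW0⟩ := hflat.1.exists_isExtension hu
  have hw := isField_const hW0
  obtain ⟨l, hl, hlc, x, hx⟩ := exists_contDiff_deriv_deriv_ne_zero
  have hform : ∀ i j k, (B₁.inCoordinates φ).form u i j k u = (B₁.inCoordinates φ).b u i j k := by
    intro i j k; rw [form, sub_self, mul_zero, add_zero]
  have hl2 := contDiff_deriv (contDiff_deriv hl)
  have hX : (fun x => ((∑ k, (B₁.inCoordinates φ).b u i j k * η k m)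
      - ∑ k, (B₁.inCoordinates φ).b u m j k * η k i) * deriv (deriv l) x) = 0 := by
    refine eq_zero_of_forall_integral_mul_eq_zero (continuous_const.mul hl2.continuous)
      fun f hf hfc => ?_
    obtain ⟨R, -, hfR⟩ := eq_zero_of_le_abs_of_hasCompactSupport hfc
    obtain ⟨R', -, hlR⟩ := eq_zero_of_le_abs_of_hasCompactSupport hlc
    have key := hW.integral_form_eq h₁ h₂ hΩ hφΩ hK hcomp hflat hw (w₀ := φ.symm u)
      (R := max R R') (fun _ _ => rfl) hf (fun x hx => hfR x ((le_max_left _ _).trans hx)) hl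
      (fun x hx => hlR x ((le_max_right _ _).trans hx)) i j m
    have hpull : ∀ (i j m : Fin N) (f l : ℝ → ℝ),
        ∫ x, f x * ∑ k, (B₁.inCoordinates φ).b u i j k * (η k m * deriv (deriv l) x)
          = (∑ k, (B₁.inCoordinates φ).b u i j k * η k m) * ∫ x, f x * deriv (deriv l) x := by
      intro i j m f l
      rw [← integral_const_mul]
      refine integral_congr_ae (Filter.Eventually.of_forall fun x => ?_)
      simp only [← mul_assoc, ← Finset.sum_mul]
      ring
    have e2 : ∫ x, l x * deriv (deriv f) x = ∫ x, f x * deriv (deriv l) x := by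
      rw [integral_mul_deriv_eq_neg hl (contDiff_deriv hf) (Or.inl hlc),
        integral_mul_deriv_eq_neg hf (contDiff_deriv hl) (Or.inl hfc)]
      simp only [mul_comm]
    simp only [φ.right_inv hu, deriv_const, mul_zero, zero_add, hform, deriv_const_mul_field',
      hpull, e2] at key
    simp only [mul_left_comm (f _), integral_const_mul]
    rw [sub_mul, key, sub_self]
  have h0 := congrFun hX x
  exact sub_eq_zero.1 ((mul_eq_zero.1 h0).resolve_right hx)

/-- When `f` is also a plateau, `f' = 0` on the support of `l` and the right side of
`integral_form_eq` vanishes. The left side is the variation of `∫ θ_k(u) u^k_x dx` along `η l'`,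
that is, `l'` paired with `dθ(η, u_x)`. -/
theorem Compatible.sum_mul_pd_form_sub (hcomp : Compatible Ω B₁ B₂) (h₁ : B₁.SmoothOn Ω)
    (h₂ : B₂.SmoothOn Ω) (hΩ : IsOpen Ω) (hφΩ : φ.source ⊆ Ω) (hK : B₂.K = 0)
    (hflat : IsFlatCoordinates B₂ φ η) {u : Vec N} (hu : u ∈ φ.target) (i j k m : Fin N) :
    ∑ s, (pd s ((B₁.inCoordinates φ).form u i j k) u - pd k ((B₁.inCoordinates φ).form u i j s) u)
      * η s m = 0 := by
  have hφ := hflat.1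
  obtain ⟨W, h, hW, hW0⟩ := hφ.exists_isExtension hu
  obtain ⟨w, s, hs, hw, hc, hw0, hd⟩ := hφ.exists_isField hW.isOpen hu hW0 k
  have hws : ∀ x, w x ∈ φ.source := fun x => hW.subset (hw.2.1 x)
  have hwt : ∀ x, φ (w x) ∈ φ.target := fun x => φ.map_source (hws x)
  have hU := hφ.contDiff_comp hw.1 hws
  have hUk := contDiff_pi.1 hU
  have hUc : ∀ x, 3 ≤ |x| → φ (w x) = u := fun x hx => by rw [hc x hx, φ.right_inv hu]
  have hU1 : ∀ k, ContDiff ℝ ∞ (deriv fun y => φ (w y) k) := fun k => contDiff_deriv (hUk k)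
  set θ : Fin N → Vec N → ℝ := fun k => (B₁.inCoordinates φ).form u i j k with hθdef
  have hθ : ∀ k x, ContDiffAt ℝ ∞ (θ k) (φ (w x)) := fun k x =>
    form_contDiffAt h₁ hΩ hφ hφΩ (hwt x) u i j k
  have hpθ : ∀ s k, ContDiff ℝ ∞ fun x => pd s (θ k) (φ (w x)) := fun s k =>
    contDiff_comp_of_contDiffAt (fun x => ContDiffAt.pd (hθ k x) s) hU
  set X : ℝ → ℝ := fun x => ∑ k, (∑ s, (pd s (θ k) (φ (w x)) - pd k (θ s) (φ (w x))) * η s m)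
    * deriv (fun y => φ (w y) k) x with hX
  have hXs : ContDiff ℝ ∞ X := ContDiff.sum fun k _ => ContDiff.mul (ContDiff.sum fun s _ =>
    ((hpθ s k).sub (hpθ k s)).mul contDiff_const) (hU1 k)
  have hdU : ∀ l x, 4 ≤ |x| → deriv (fun y => φ (w y) l) x = 0 := fun l x hx =>
    deriv_eq_zero_of_const (R := 3) (c := u l) (fun y hy => by rw [hUc y hy]) (by linarith)
  have hXc : HasCompactSupport X := hasCompactSupport_of_eq_zero (R := 4) fun x hx =>
    Finset.sum_eq_zero fun k _ => by rw [hdU k x hx, mul_zero]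
  have hX0 : X = 0 := by
    refine eq_zero_of_forall_integral_deriv_mul_eq_zero hXs hXc fun l hl hlc => ?_
    obtain ⟨R', hR', hlR'⟩ := eq_zero_of_le_abs_of_hasCompactSupport hlc
    set R := max R' 3 + 1 with hR
    obtain ⟨f, hf, -, hf1, hf2⟩ := exists_plateau R
    have hRpos : 3 ≤ R := by linarith [le_max_right R' 3]
    -- With `|R| = R` the plateau `f` vanishes from `R + 2` on, the radius passed to
    -- `integral_form_eq`.
    rw [abs_of_nonneg (by linarith)] at hf2
    have hdl : ∀ x, R ≤ |x| → deriv l x = 0 := fun x hx =>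
      deriv_eq_zero_of_const hlR' (by linarith [le_max_left R' 3])
    have hddl : ∀ x, R < |x| → deriv (deriv l) x = 0 := fun x hx =>
      deriv_eq_zero_of_const hdl hx
    have hdf : ∀ x, |x| < R → deriv f =ᶠ[nhds x] fun _ => 0 := by
      intro x hx
      have : f =ᶠ[nhds x] fun _ => 1 := by
        filter_upwards [(isOpen_lt continuous_abs continuous_const).mem_nhds hx] with y hy
        exact hf1 y (le_of_lt hy)
      have h2 := this.deriv
      simpa using h2
    have key := hW.integral_form_eq h₁ h₂ hΩ hφΩ hK hcomp hflat hw (w₀ := φ.symm u)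
      (R := R + 2) (fun x hx => hc x (by linarith)) hf hf2 hl
      (fun x hx => hlR' x (by linarith [le_max_left R' 3])) i j m
    simp only [φ.right_inv hu, deriv_const_mul_field'] at key
    have e1 : ∀ x, l x * ∑ k, ((∑ s, pd s ((B₁.inCoordinates φ).form u m j k) (φ (w x))
          * (η s i * deriv f x)) * deriv (fun y => φ (w y) k) x
        + (B₁.inCoordinates φ).form u m j k (φ (w x)) * (η k i * deriv (deriv f) x)) = 0 := by
      intro x
      rcases lt_or_ge |x| R with hx | hx
      · have h2 : deriv (deriv f) x = 0 := by rw [(hdf x hx).deriv_eq, deriv_const]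
        simp [(hdf x hx).eq_of_nhds, h2]
      · rw [hlR' x (by linarith [le_max_left R' 3]), zero_mul]
    have e2 : ∀ x, f x * ∑ k, ((∑ s, pd s (θ k) (φ (w x))
          * (η s m * deriv l x)) * deriv (fun y => φ (w y) k) x
        + θ k (φ (w x)) * (η k m * deriv (deriv l) x))
        = ∑ k, (deriv l x * ((∑ s, pd s (θ k) (φ (w x)) * η s m) * deriv (fun y => φ (w y) k) x)
          + η k m * (θ k (φ (w x)) * deriv (deriv l) x)) := by
      intro x
      rcases le_or_gt |x| R with hx | hx
      · rw [hf1 x hx, one_mul]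
        refine Finset.sum_congr rfl fun k _ => ?_
        simp only [← mul_assoc, ← Finset.sum_mul]
        ring
      · simp [hddl x hx, hdl x hx.le]
    simp only [e1, integral_zero] at key
    refine (integral_variation_eq hU hθ (fun s => η s m) hl hlc).symm.trans ?_
    simp only [← e2]
    exact key
  have h0 := congrFun hX0 0
  simp only [hX, hd, hw0, mul_ite, mul_zero, Finset.sum_ite_eq', Finset.mem_univ, if_true,
    Pi.zero_apply] at h0
  exact (mul_eq_zero.1 h0).resolve_right hs

end Bracket

/-! ### Closed forms and flat coordinates -/


/-- The Poincaré lemma for `Σ θ_k du^k` on a convex set; the primitive is smooth because its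
derivative is. -/
theorem exists_pd_eq_of_closed {V : Set (Vec N)} (hV : IsOpen V) (hVc : Convex ℝ V)
    {θ : Fin N → Vec N → ℝ} (hθ : ∀ k, ∀ u ∈ V, ContDiffAt ℝ ∞ (θ k) u)
    (hcl : ∀ u ∈ V, ∀ s k, pd s (θ k) u = pd k (θ s) u) :
    ∃ F : Vec N → ℝ, ContDiffOn ℝ ∞ F V ∧ ∀ u ∈ V, ∀ k, pd k F u = θ k u := by
  let p : Fin N → Vec N →L[ℝ] ℝ := fun k => ContinuousLinearMap.proj k
  let α : Vec N → Vec N →L[ℝ] ℝ := fun u => ∑ k, θ k u • p k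
  have hα : ContDiffOn ℝ ∞ α V := fun u hu =>
    (ContDiffAt.sum fun k _ => (hθ k u hu).smul contDiffAt_const).contDiffWithinAt
  have hαd : ∀ u ∈ V, ∀ x y, fderiv ℝ α u x y = ∑ k, (∑ s, pd s (θ k) u * x s) * y k := by
    intro u hu x y
    have h : HasFDerivAt α (∑ k, (fderiv ℝ (θ k) u).smulRight (p k)) u :=
      HasFDerivAt.fun_sum fun k _ =>
        (((hθ k u hu).differentiableAt (by simp)).hasFDerivAt).smul_const (p k)
    rw [h.fderiv]
    simp [p, fderiv_apply_eq_sum_pd (θ _) u x]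
  obtain ⟨F, hF⟩ := hVc.exists_forall_hasFDerivAt_of_fderiv_symmetric hV
    (hα.differentiableOn (by simp)) fun u hu x y => by
      rw [hαd u hu, hαd u hu]
      simp only [Finset.sum_mul]
      rw [Finset.sum_comm]
      refine Finset.sum_congr rfl fun s _ => Finset.sum_congr rfl fun k _ => ?_
      rw [hcl u hu s k]
      ring
  refine ⟨F, ?_, fun u hu k => ?_⟩
  · rw [contDiffOn_infty_iff_fderiv_of_isOpen hV]
    exact ⟨fun u hu => (hF u hu).differentiableAt.differentiableWithinAt,
      hα.congr fun u hu => (hF u hu).fderiv⟩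
  · rw [pd, (hF u hu).fderiv]
    simp [α, p, Pi.single_apply]

namespace Bracket

variable {B B₁ B₂ : Bracket N} {Ω : Set (Vec N)} {η : Matrix (Fin N) (Fin N) ℝ}

/-- At a single point of nondegeneracy `η = J g Jᵀ` with `J` invertible, and `η` is constant. -/
theorem det_ne_zero_of_flat (hflat : IsFlatCoordinates B φ η)
    (hB : B.IsNondegenerateOn φ.source) : η.det ≠ 0 := by
  obtain ⟨w, hw, hdet⟩ := hB
  let J : Matrix (Fin N) (Fin N) ℝ := fun i a => pd a (fun w => φ w i) w
  let J' : Matrix (Fin N) (Fin N) ℝ := fun c k => pd k (fun u => φ.symm u c) (φ w)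
  have hJ : J * J' = 1 := by
    ext i k
    rw [Matrix.mul_apply, Matrix.one_apply]
    exact hflat.1.sum_pd_mul_pd_symm hw i k
  have hη : η = J * B.g w * J.transpose := by
    rw [← (hflat.2 (φ w) (φ.map_source hw)).1]
    ext i j
    simp only [Matrix.mul_apply, Matrix.transpose_apply, Finset.sum_mul]
    rw [Finset.sum_comm]
    simp only [inCoordinates, φ.left_inv hw]
    rfl
  have hJd : J.det ≠ 0 := by
    intro h
    have := congrArg Matrix.det hJ
    rw [Matrix.det_mul, h, zero_mul, Matrix.det_one] at this
    exact zero_ne_one this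
  rw [hη, Matrix.det_mul, Matrix.det_mul, Matrix.det_transpose]
  exact mul_ne_zero (mul_ne_zero hJd hdet) hJd

/-- The base point changes the form only by constants, so closedness proved at `u` with base point
`u` transfers to the fixed base point `0`. -/
theorem pd_form_eq (C : Bracket N) (c : Vec N) (i j k s : Fin N) (u : Vec N) :
    pd s (C.form c i j k) u = pd s (C.form 0 i j k) u := by
  have : C.form c i j k = fun u => C.form 0 i j k u
      + -(C.K * (if i = k then 1 else 0) * c j) := by
    funext u; simp only [form, Pi.zero_apply]; ring
  rw [this, pd, fderiv_add_const]
  rfl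

theorem Compatible.pd_form_comm (hcomp : Compatible Ω B₁ B₂) (h₁ : B₁.SmoothOn Ω)
    (h₂ : B₂.SmoothOn Ω) (hΩ : IsOpen Ω) (hφΩ : φ.source ⊆ Ω) (hK : B₂.K = 0)
    (hflat : IsFlatCoordinates B₂ φ η) (hη : η.det ≠ 0) {u : Vec N} (hu : u ∈ φ.target)
    (i j k s : Fin N) :
    pd s ((B₁.inCoordinates φ).form 0 i j k) u = pd k ((B₁.inCoordinates φ).form 0 i j s) u := by
  have h := Matrix.eq_zero_of_vecMul_eq_zero hη (v := fun s =>
    pd s ((B₁.inCoordinates φ).form 0 i j k) u - pd k ((B₁.inCoordinates φ).form 0 i j s) u)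
    (by
      funext m
      have := hcomp.sum_mul_pd_form_sub h₁ h₂ hΩ hφΩ hK hflat hu i j k m
      simpa only [Matrix.vecMul, dotProduct, pd_form_eq _ u, Pi.zero_apply] using this)
  exact sub_eq_zero.1 (congrFun h s)

/-! ### Liouville functions and Liouville coordinates -/

theorem pd_of_isLiouvilleFunction {C : Bracket N} {V : Set (Vec N)}
    {Φ : Vec N → Matrix (Fin N) (Fin N) ℝ} (hΦ : IsLiouvilleFunction C V Φ) {u : Vec N}
    (hu : u ∈ V) (i j k : Fin N) : pd k (fun v => Φ v i j) u = C.form 0 i j k u := by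
  rw [form, (hΦ.2 u hu i j).2 k, Pi.zero_apply]
  ring

/-- Potentials `F^{ij}` of the closed forms already have the right derivatives. By skew-symmetry the
defect in the formula for `g` has zero gradient, so it is a constant on the connected set `V`. -/
theorem Compatible.exists_isLiouvilleFunction (hcomp : Compatible Ω B₁ B₂) (h₁ : B₁.SmoothOn Ω)
    (h₂ : B₂.SmoothOn Ω) (hΩ : IsOpen Ω) (hφΩ : φ.source ⊆ Ω) (hK : B₂.K = 0)
    (hflat : IsFlatCoordinates B₂ φ η) (hη : η.det ≠ 0) {V : Set (Vec N)} (hV : IsOpen V)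
    (hVc : Convex ℝ V) (hVφ : V ⊆ φ.target) :
    ∃ Φ, IsLiouvilleFunction (B₁.inCoordinates φ) V Φ := by
  have hφ := hflat.1
  have hP : B₁.IsPoisson Ω := by simpa [lin_one_zero] using hcomp 1 0
  choose F hFs hF using fun i j => exists_pd_eq_of_closed hV hVc
    (θ := (B₁.inCoordinates φ).form 0 i j)
    (fun k u hu => form_contDiffAt h₁ hΩ hφ hφΩ (hVφ hu) 0 i j k)
    (fun u hu s k => hcomp.pd_form_comm h₁ h₂ hΩ hφΩ hK hflat hη (hVφ hu) i j k s)
  set C := B₁.inCoordinates φ with hC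
  -- A base point is needed to name the constant defect.
  rcases V.eq_empty_or_nonempty with rfl | ⟨u₀, hu₀⟩
  · exact ⟨0, fun i j => contDiffOn_empty, by simp⟩
  let D : Fin N → Fin N → Vec N → ℝ := fun i j u =>
    C.g u i j - F i j u - F j i u + C.K * (u i * u j)
  have hFd : ∀ i j, ∀ u ∈ V, DifferentiableAt ℝ (F i j) u := fun i j u hu =>
    ((hFs i j).contDiffAt (hV.mem_nhds hu)).differentiableAt (by simp)
  have hgd : ∀ i j, ∀ u ∈ V, DifferentiableAt ℝ (fun u => C.g u i j) u := fun i j u hu =>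
    (inCoordinates_g_contDiffAt h₁ hΩ hφ hφΩ (hVφ hu) i j).differentiableAt (by simp)
  have hDd : ∀ i j, ∀ u ∈ V, HasFDerivAt (D i j) (fderiv ℝ (fun u => C.g u i j) u
      - fderiv ℝ (F i j) u - fderiv ℝ (F j i) u
      + C.K • (u i • (ContinuousLinearMap.proj j : Vec N →L[ℝ] ℝ)
        + u j • (ContinuousLinearMap.proj i : Vec N →L[ℝ] ℝ))) u := fun i j u hu =>
    ((((hgd i j u hu).hasFDerivAt.sub (hFd i j u hu).hasFDerivAt).sub
      (hFd j i u hu).hasFDerivAt).add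
      (((ContinuousLinearMap.proj (R := ℝ) (φ := fun _ : Fin N => ℝ) i).hasFDerivAt.mul
        (ContinuousLinearMap.proj (R := ℝ) (φ := fun _ : Fin N => ℝ) j).hasFDerivAt).const_mul C.K))
  have hpD : ∀ i j, ∀ u ∈ V, ∀ k, pd k (D i j) u = 0 := by
    intro i j u hu k
    have e1 := hP.pd_inCoordinates_g h₁ hΩ hφ hφΩ (hVφ hu) j i k
    have e2 := hF i j u hu k
    have e3 := hF j i u hu k
    simp only [← hC, pd, form, Pi.zero_apply] at e1 e2 e3
    rw [pd, (hDd i j u hu).fderiv]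
    simp only [add_apply, sub_apply, e1, e2, e3,
      smul_apply, ContinuousLinearMap.proj_apply, Pi.single_apply, smul_eq_mul]
    ring
  have hDc : ∀ i j, ∀ u ∈ V, D i j u = D i j u₀ := by
    intro i j u hu
    refine hV.is_const_of_fderiv_eq_zero hVc.isPreconnected
      (fun u hu => (hDd i j u hu).differentiableAt.differentiableWithinAt) (fun u hu => ?_) hu hu₀
    ext v
    rw [fderiv_apply_eq_sum_pd]
    simp [hpD i j u hu]
  have hDsymm : ∀ i j, D i j u₀ = D j i u₀ := by
    intro i j
    have := hP.inCoordinates_g_symm hφ hφΩ (hVφ hu₀) i j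
    simp only [D]
    rw [← hC] at this
    rw [this]
    ring
  -- The defect is symmetric in `i` and `j`, so giving half of it to each of `Φ^{ij}` and `Φ^{ji}`
  -- absorbs it.
  refine ⟨fun u => fun i j => F i j u + D i j u₀ / 2, fun i j => (hFs i j).add contDiffOn_const,
    fun u hu i j => ⟨?_, fun k => ?_⟩⟩
  · have h1 := hDc i j u hu
    have h2 := hDsymm i j
    simp only [D] at h1 h2 ⊢
    linarith
  · have h1 : pd k (fun v => F i j v + D i j u₀ / 2) u = pd k (F i j) u := by
      rw [pd, fderiv_add_const]; rfl
    rw [h1, hF i j u hu k, form, Pi.zero_apply]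
    ring

/-- The required `Hʲ` must satisfy `∂_l Hʲ = (η⁻¹ Φ)_l^j`. This is integrable because the matrix `M
= (∂_k Φ^{ij})` at fixed `j` has `M η` symmetric, hence `η⁻¹ M` symmetric. -/
theorem Compatible.exists_potential (hcomp : Compatible Ω B₁ B₂) (h₁ : B₁.SmoothOn Ω)
    (h₂ : B₂.SmoothOn Ω) (hΩ : IsOpen Ω) (hφΩ : φ.source ⊆ Ω) (hK : B₂.K = 0)
    (hflat : IsFlatCoordinates B₂ φ η) (hη : η.det ≠ 0) {V : Set (Vec N)} (hV : IsOpen V)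
    (hVc : Convex ℝ V) (hVφ : V ⊆ φ.target) {Φ : Vec N → Matrix (Fin N) (Fin N) ℝ}
    (hΦ : IsLiouvilleFunction (B₁.inCoordinates φ) V Φ) :
    ∃ H : Vec N → Vec N, ContDiffOn ℝ ∞ H V ∧
      ∀ u ∈ V, ∀ i j, Φ u i j = ∑ s, η i s * pd s (fun v => H v j) u := by
  have hφ := hflat.1
  have hP₂ : B₂.IsPoisson Ω := by simpa [lin] using hcomp 0 1
  have hunit : IsUnit η.det := isUnit_iff_ne_zero.2 hη
  have hΦs : ∀ i j, ∀ u ∈ V, ContDiffAt ℝ ∞ (fun u => Φ u i j) u := fun i j u hu =>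
    (hΦ.1 i j).contDiffAt (hV.mem_nhds hu)
  have hpd : ∀ (j l k : Fin N), ∀ u ∈ V, pd k (fun u => ∑ i, η⁻¹ l i * Φ u i j) u
      = ∑ i, η⁻¹ l i * (B₁.inCoordinates φ).form 0 i j k u := by
    intro j l k u hu
    have h : HasFDerivAt (fun u => ∑ i, η⁻¹ l i * Φ u i j)
        (∑ i, η⁻¹ l i • fderiv ℝ (fun u => Φ u i j) u) u :=
      HasFDerivAt.fun_sum fun i _ =>
        (((hΦs i j u hu).differentiableAt (by simp)).hasFDerivAt).const_mul (η⁻¹ l i)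
    rw [pd, h.fderiv]
    simp only [sum_apply, smul_apply, smul_eq_mul,
      ← pd_of_isLiouvilleFunction hΦ hu]
    rfl
  have hcl : ∀ j, ∀ u ∈ V, ∀ s k, pd s (fun u => ∑ i, η⁻¹ k i * Φ u i j) u
      = pd k (fun u => ∑ i, η⁻¹ s i * Φ u i j) u := by
    intro j u hu s k
    rw [hpd j k s u hu, hpd j s k u hu]
    have hηs : η.transpose = η := by
      ext a b
      have := hP₂.inCoordinates_g_symm hφ hφΩ (hVφ hu) b a
      rwa [(hflat.2 u (hVφ hu)).1] at this
    let M : Matrix (Fin N) (Fin N) ℝ := fun i k => (B₁.inCoordinates φ).form 0 i j k u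
    -- Besides the symmetric `b^{ij}_k η^{km}`, the form contributes `K uʲ η^{im}`, symmetric
    -- because `η` is.
    have hM : M * η = η * M.transpose := by
      have : M * η = (M * η).transpose := by
        ext i m
        rw [Matrix.transpose_apply, Matrix.mul_apply, Matrix.mul_apply]
        have hb := hcomp.sum_b_mul_eq h₁ h₂ hΩ hφΩ hK hflat (hVφ hu) i j m
        have hs : η i m = η m i := congrFun (congrFun hηs m) i
        simp only [M, form, add_mul, Finset.sum_add_distrib, hb, Pi.zero_apply, mul_ite, ite_mul,
          mul_one, mul_zero, zero_mul, Finset.sum_ite_eq, Finset.mem_univ, if_true, hs]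
      rw [this, Matrix.transpose_mul, hηs]
    have hAs : (η⁻¹).transpose = η⁻¹ := by rw [Matrix.transpose_nonsing_inv, hηs]
    have hAM : η⁻¹ * M = (η⁻¹ * M).transpose := by
      have h2 : η⁻¹ * (M * η) * η⁻¹ = η⁻¹ * (η * M.transpose) * η⁻¹ := by rw [hM]
      rw [Matrix.mul_assoc, Matrix.mul_assoc M, Matrix.mul_nonsing_inv _ hunit, Matrix.mul_one,
        ← Matrix.mul_assoc η⁻¹ η, Matrix.nonsing_inv_mul _ hunit, Matrix.one_mul] at h2
      rw [Matrix.transpose_mul, hAs, h2]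
    have := congrFun (congrFun hAM k) s
    rw [Matrix.transpose_apply, Matrix.mul_apply, Matrix.mul_apply] at this
    exact this
  choose H hHs hH using fun j => exists_pd_eq_of_closed hV hVc
    (θ := fun l u => ∑ i, η⁻¹ l i * Φ u i j)
    (fun l u hu => ContDiffAt.sum fun i _ => contDiffAt_const.mul (hΦs i j u hu)) (hcl j)
  refine ⟨fun u j => H j u, contDiffOn_pi.2 hHs, fun u hu i j => ?_⟩
  have h2 : η * (η⁻¹ * Φ u) = Φ u := by
    rw [← Matrix.mul_assoc, Matrix.mul_nonsing_inv _ hunit, Matrix.one_mul]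
  calc Φ u i j = (η * (η⁻¹ * Φ u)) i j := by rw [h2]
    _ = ∑ s, η i s * pd s (H j) u := by
      rw [Matrix.mul_apply]
      refine Finset.sum_congr rfl fun s _ => ?_
      rw [hH j u hu s, Matrix.mul_apply]

/-- The density of `{Uⁱ, Uʲ}` is the total derivative of `Φ^{ij}(u) - K cʲ uⁱ`, with `c` the value
of `u` at infinity. The correction accounts for `dinv uʲ_x = uʲ - cʲ`, while `dΦ^{ij}` is the form
with base point `0`. -/
theorem isLiouvilleCoordinates_of_isLiouvilleFunction (hφ : IsCoordinates φ) {V : Set (Vec N)}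
    (hV : IsOpen V) {Φ : Vec N → Matrix (Fin N) (Fin N) ℝ}
    (hΦ : IsLiouvilleFunction (B.inCoordinates φ) V Φ) :
    IsLiouvilleCoordinates B φ (φ.source ∩ φ ⁻¹' V) := by
  intro i j w hw
  have hW : IsOpen (φ.source ∩ φ ⁻¹' V) := φ.isOpen_inter_preimage hV
  have hws : ∀ x, w x ∈ φ.source := fun x => (hw.2.1 x).1
  have hwV : ∀ x, φ (w x) ∈ V := fun x => (hw.2.1 x).2
  obtain ⟨c, R, hR, -, hc⟩ := hw.exists_const
  have hU := hφ.contDiff_comp hw.1 hws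
  have hUk := contDiff_pi.1 hU
  have hUc : ∀ x, R ≤ |x| → φ (w x) = φ c := fun x hx => by rw [hc x hx]
  have hvar : ∀ i, varDeriv (coordFunctional φ i) w
      = fun x k => pd k (fun u => φ u i) (w x) := fun i =>
    (isVarDeriv_coordFunctional hW i (fun u hu => hφ.contDiffAt_coe hu.1 i) hw).varDeriv_eq
  have hΦs : ContDiff ℝ ∞ fun x => Φ (φ (w x)) i j :=
    contDiff_comp_of_contDiffAt (f := fun u => Φ u i j)
      (fun x => (hΦ.1 i j).contDiffAt (hV.mem_nhds (hwV x))) hU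
  rw [bracket, ← integral_deriv_eq_zero_of_const
    (F := fun x => Φ (φ (w x)) i j - (B.inCoordinates φ).K * φ c j * φ (w x) i)
    (hΦs.sub (contDiff_const.mul (hUk i))) (R := R)
    (c := Φ (φ c) i j - (B.inCoordinates φ).K * φ c j * φ c i) fun x hx => by rw [hUc x hx]]
  refine integral_congr_ae (Filter.Eventually.of_forall fun x => ?_)
  -- `g = 1` turns the covector field `g dφʲ` into the variational derivative of `Uʲ`.
  have hop := B.sum_pd_mul_op hφ hw.1 hws (g := fun _ => 1) contDiff_const i j x
  simp only [one_mul] at hop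
  simp only [hvar]
  rw [hop]
  have hd : HasDerivAt (fun x => Φ (φ (w x)) i j - (B.inCoordinates φ).K * φ c j * φ (w x) i)
      ((∑ k, pd k (fun v => Φ v i j) (φ (w x)) * deriv (fun y => φ (w y) k) x)
        - (B.inCoordinates φ).K * φ c j * deriv (fun y => φ (w y) i) x) x := by
    refine HasDerivAt.sub ?_ (((hUk i).differentiable (by simp) x).hasDerivAt.const_mul _)
    refine hasDerivAt_comp_pd (f := fun v => Φ v i j) (γ := fun x => φ (w x))
      (((hΦ.1 i j).contDiffAt (hV.mem_nhds (hwV x))).differentiableAt (by simp)) ?_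
    exact hasDerivAt_pi.2 fun k => ((hUk k).differentiable (by simp) x).hasDerivAt
  rw [hd.deriv]
  have hq : dinv (fun y => deriv (fun z => φ (w z) j) y) x = φ (w x) j - φ c j :=
    dinv_deriv (hUk j) (fun y hy => by rw [hUc y hy]) x
  simp only [scalarOp, hq, deriv_const, mul_zero, zero_add, mul_one,
    pd_of_isLiouvilleFunction hΦ (hwV x), form, Pi.zero_apply, sub_zero, add_mul,
    Finset.sum_add_distrib, mul_ite, ite_mul, zero_mul, Finset.sum_ite_eq, Finset.mem_univ,
    if_true]
  ring

end Bracket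
end HydroBracket

/-! ### The theorem -/

theorem mainTheorem5 {N : ℕ} (Ω : Set (HydroBracket.Vec N)) (hΩ : IsOpen Ω)
    (B₁ B₂ : HydroBracket.Bracket N)
    (h₁ : B₁.SmoothOn Ω) (h₂ : B₂.SmoothOn Ω)
    (hlocal : B₂.K = 0)
    (hcomp : HydroBracket.Bracket.Compatible Ω B₁ B₂)
    (φ : OpenPartialHomeomorph (HydroBracket.Vec N) (HydroBracket.Vec N))
    (hφΩ : φ.source ⊆ Ω)
    (hnondeg : B₂.IsNondegenerateOn φ.source)
    (η : Matrix (Fin N) (Fin N) ℝ)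
    (hflat : HydroBracket.IsFlatCoordinates B₂ φ η)
    (V : Set (HydroBracket.Vec N)) (hV : IsOpen V) (hVconv : Convex ℝ V) (hVφ : V ⊆ φ.target) :
    HydroBracket.IsLiouvilleCoordinates B₁ φ (φ.source ∩ φ ⁻¹' V) ∧
    (∃ Φ, HydroBracket.IsLiouvilleFunction (B₁.inCoordinates φ) V Φ) ∧
    ∀ Φ, HydroBracket.IsLiouvilleFunction (B₁.inCoordinates φ) V Φ →
      ∃ H : HydroBracket.Vec N → HydroBracket.Vec N, ContDiffOn ℝ ∞ H V ∧
        ∀ u ∈ V, ∀ i j,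
          Φ u i j = ∑ s, η i s * HydroBracket.pd s (fun v => H v j) u := by
  have hη := HydroBracket.Bracket.det_ne_zero_of_flat hflat hnondeg
  obtain ⟨Φ, hΦ⟩ :=
    hcomp.exists_isLiouvilleFunction h₁ h₂ hΩ hφΩ hlocal hflat hη hV hVconv hVφ
  exact ⟨HydroBracket.Bracket.isLiouvilleCoordinates_of_isLiouvilleFunction hflat.1 hV hΦ,
    ⟨Φ, hΦ⟩, fun Ψ hΨ => hcomp.exists_potential h₁ h₂ hΩ hφΩ hlocal hflat hη hV hVconv hVφ hΨ⟩
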